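/- A two-player game $G$ consists of finite question sets $X,Y$, finite non-empty answer sets $A,B$, a probability distribution $Q$ on $X\times Y$ (pairs of questions may have probability $0$, i.e. complete support is not assumed) and a winning condition $R:X\times Y\times A\times B\to\{0,1\}$. A strategy $O(a,b|x,y)$ is a conditional probability distribution defined for all $(x,y)\in X\times Y$. It is non-signalling if $O(\circ,b|x,y)=\sum_a O(a,b|x,y)$ does not depend on $x$ and $O(a,\circ|x,y)=\sum_b O(a,b|x,y)$ does not depend on $y$. Let $w_{\mathrm{ns}}(G)=1-\alpha$ be the supremum of $\sum_{x,y,a,b}Q(x,y)R(x,y,a,b)O(a,b|x,y)$ over non-signalling strategies $O$. In the repeated game $G^n$, $n$ question pairs are drawn independently from $Q$ and asked at once; a strategy for $G^n$ is a strategy with question sets $X^n,Y^n$ and answer sets $A^n,B^n$, and it is non-signalling if it is so between the two players. Let $d=|X||Y|(|A|+|B|)$. For $\eta>0$ put $\omega_\eta(x,y)=Q(x,y)$ if $Q(x,y)\ne0$ and $\omega_\eta(x,y)=\eta$ otherwise, and consider the linear program, in variables $O(a,b|x,y)\ge 0$, \[ \begin{aligned} \max\ & \sum_{x,y,a,b}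 Q(x,y)R(x,y,a,b)O(a,b|x,y)\\ \text{s.t. } & \omega_\eta(x,y)\Big[O(\circ,b|x,y)-\sum_{r\in X}Q(r|y)\,O(\circ,b|r,y)\Big]\le 0 && \forall x,y,b,\\ & \omega_\eta(x,y)\Big[O(a,\circ|x,y)-\sum_{r\in Y}Q(r|x)\,O(a,\circ|x,r)\Big]\le 0 && \forall x,y,a,\\ & \sum_{a,b}O(a,b|x,y)\le 1 && \forall x,y, \end{aligned} \] where a conditional probability given an event of probability $0$ is read as $0$. The first two lines contain $d$ constraints. Then, for every two-player game $G$: 1. For every $\eta>0$ the optimal value of this program is $1-\alpha$, and its dual program has an optimal solution in which each of the $d$ dual variables $y_k\ge 0$ belonging to the first two lines of constraints is at most $1$; consequently $\kappa=\sum_k|y_k|\le d$, independently of $\eta$. 2. There are a polynomial $\mathcal C_1(G,n)$ in $n$ and a constant $\mathcal C_2(G)>0$, with \[ \mathcal C_1(G,n)<20\,|X\times Y|\,|A\times B|\,(n+1)^{2(|X\times Y||A\times B|-1)}\quad\text{for all } n\ge 0,\qquad \mathcal C_2(G)\ge(20d)^{-2}, \] such that for every $0<\beta\le\alpha$, for all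 large enough $n$, and for every non-signalling strategy for $G^n$, the probability that the players win more than a fraction $1-\alpha+\beta$ of the $n$ instances is at most $\mathcal C_1(G,n)\exp\left[-\mathcal C_2(G)\,n\beta^2\right]$. -/

import Mathlib

/-- A two-player game: finite question sets `X`, `Y`, finite answer sets `A`, `B`, a probability
distribution `Q` on pairs of questions (some pairs may have probability zero) and a winning
condition `R`. -/
structure TwoPlayerGame (X Y A B : Type*) [Fintype X] [Fintype Y] where
  Q : X → Y → ℝ
  Q_nonneg : ∀ x y, 0 ≤ Q x y
  Q_sum : ∑ x, ∑ y, Q x y = 1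
  R : X → Y → A → B → Bool

/-- `O x y a b` is a conditional probability distribution `O(a, b | x, y)`, defined for all pairs of
questions, in which the marginal on the answers of each player does not depend on the question of
the other player. Strategies for `n` repetitions are the case of the sets `Fin n → X` etc. -/
structure IsNonSignalling {X Y A B : Type*} [Fintype A] [Fintype B]
    (O : X → Y → A → B → ℝ) : Prop where
  nonneg : ∀ x y a b, 0 ≤ O x y a b
  sum_one : ∀ x y, ∑ a, ∑ b, O x y a b = 1
  first_to_second : ∀ x x' y b, ∑ a, O x y a b = ∑ a, O x' y a b
  second_to_first : ∀ x y y' a, ∑ b, O x y a b = ∑ b, O x y' a b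

/-- The data of the linear program `max obj · x` subject to `coeff x ≤ rhs`, `0 ≤ x`, with variables
indexed by `V` and constraints indexed by `K`. Its dual is `min rhs · y` subject to
`obj ≤ coeffᵀ y`, `0 ≤ y`. -/
structure LinearProgram (V K : Type*) where
  coeff : K → V → ℝ
  rhs : K → ℝ
  obj : V → ℝ

namespace LinearProgram

variable {V K : Type*} [Fintype V] [Fintype K]

def IsFeasible (L : LinearProgram V K) (x : V → ℝ) : Prop :=
  (∀ v, 0 ≤ x v) ∧ ∀ k, ∑ v, L.coeff k v * x v ≤ L.rhs k

def value (L : LinearProgram V K) (x : V → ℝ) : ℝ := ∑ v, L.obj v * x v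

def IsDualFeasible (L : LinearProgram V K) (y : K → ℝ) : Prop :=
  (∀ k, 0 ≤ y k) ∧ ∀ v, L.obj v ≤ ∑ k, L.coeff k v * y k

def dualValue (L : LinearProgram V K) (y : K → ℝ) : ℝ := ∑ k, L.rhs k * y k

/-- `w` is the (attained) optimal value of the program. -/
def IsOptimalValue (L : LinearProgram V K) (w : ℝ) : Prop :=
  IsGreatest {v | ∃ x, L.IsFeasible x ∧ v = L.value x} w

def IsDualOptimal (L : LinearProgram V K) (y : K → ℝ) : Prop :=
  L.IsDualFeasible y ∧ ∀ y', L.IsDualFeasible y' → L.dualValue y ≤ L.dualValue y'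

end LinearProgram

/-- The variables `O(a, b | x, y)`. -/
abbrev StrategyIndex (X Y A B : Type*) := X × Y × A × B

/-- Indices of the non-signalling constraints: `Sum.inl (x, y, b)` for signalling from the first to
the second player, `Sum.inr (x, y, a)` for signalling from the second to the first. -/
abbrev SignallingIndex (X Y A B : Type*) := (X × Y × B) ⊕ (X × Y × A)

namespace TwoPlayerGame

variable {X Y A B : Type*} [Fintype X] [Fintype Y] [Fintype A] [Fintype B]

/-- The probability of winning one instance of the game. -/
noncomputable def winProb (G : TwoPlayerGame X Y A B) (O : X → Y → A → B → ℝ) : ℝ :=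
  ∑ x, ∑ y, ∑ a, ∑ b, G.Q x y * (if G.R x y a b then 1 else 0) * O x y a b

/-- The optimal non-signalling winning probability. -/
noncomputable def nsValue (G : TwoPlayerGame X Y A B) : ℝ :=
  sSup {w | ∃ O : X → Y → A → B → ℝ, IsNonSignalling O ∧ w = G.winProb O}

/-- The fraction of the `n` instances that are won, given all questions and answers. -/
noncomputable def winFrequency (G : TwoPlayerGame X Y A B) {n : ℕ}
    (xs : Fin n → X) (ys : Fin n → Y) (as : Fin n → A) (bs : Fin n → B) : ℝ :=
  (Finset.univ.filter fun j => G.R (xs j) (ys j) (as j) (bs j) = true).card / (n : ℝ)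

/-- The probability, for `n` question pairs drawn independently from `Q` and asked at once, and
answers drawn from the strategy `P`, that more than a fraction `t` of the `n` instances is won. -/
noncomputable def probWinMoreThan (G : TwoPlayerGame X Y A B) (n : ℕ)
    (P : (Fin n → X) → (Fin n → Y) → (Fin n → A) → (Fin n → B) → ℝ) (t : ℝ) : ℝ :=
  ∑ xs, ∑ ys, ∑ as, ∑ bs,
    (∏ j, G.Q (xs j) (ys j)) * P xs ys as bs *
      (if t < G.winFrequency xs ys as bs then 1 else 0)

/-- `Q(x | y)`; by convention it is `0` if `y` has probability zero. -/
noncomputable def condFirst (G : TwoPlayerGame X Y A B) (x : X) (y : Y) : ℝ :=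
  G.Q x y / ∑ r, G.Q r y

/-- `Q(y | x)`; by convention it is `0` if `x` has probability zero. -/
noncomputable def condSecond (G : TwoPlayerGame X Y A B) (x : X) (y : Y) : ℝ :=
  G.Q x y / ∑ r, G.Q x r

open Classical in
/-- The weight of the non-signalling constraints at `(x, y)`: `Q(x, y)` if this is non-zero,
and `η` otherwise. -/
noncomputable def weight (G : TwoPlayerGame X Y A B) (η : ℝ) (x : X) (y : Y) : ℝ :=
  if G.Q x y ≠ 0 then G.Q x y else η

open Classical in
/-- The linear program in the variables `O(a, b | x, y) ≥ 0`
* maximise `∑ Q(x, y) R(x, y, a, b) O(a, b | x, y)`,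
* subject to `weight x y * (O(∘, b | x, y) - ∑ r, Q(r | y) O(∘, b | r, y)) ≤ 0`,
* `weight x y * (O(a, ∘ | x, y) - ∑ r, Q(r | x) O(a, ∘ | x, r)) ≤ 0`,
* and `∑ a b, O(a, b | x, y) ≤ 1`. -/
noncomputable def modifiedLP (G : TwoPlayerGame X Y A B) (η : ℝ) :
    LinearProgram (StrategyIndex X Y A B) (SignallingIndex X Y A B ⊕ (X × Y)) where
  coeff
    | .inl (.inl (x, y, b)), (x', y', _, b') =>
        G.weight η x y *
          ((if x' = x ∧ y' = y ∧ b' = b then 1 else 0) -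
            (if y' = y ∧ b' = b then G.condFirst x' y else 0))
    | .inl (.inr (x, y, a)), (x', y', a', _) =>
        G.weight η x y *
          ((if x' = x ∧ y' = y ∧ a' = a then 1 else 0) -
            (if x' = x ∧ a' = a then G.condSecond x y' else 0))
    | .inr (x, y), (x', y', _, _) => if x' = x ∧ y' = y then 1 else 0
  rhs
    | .inl _ => 0
    | .inr _ => 1
  obj
    | (x, y, a, b) => G.Q x y * (if G.R x y a b then 1 else 0)

end TwoPlayerGame

/-!
A strategy `O`, possibly signalling and possibly not normalised, beats the non-signalling value by at
most its amount of signalling, measured by the excess of the marginals of `O(a, b | x, y)` over their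
averages `O(b | y) = ∑ r, Q(r | y) O(∘, b | r, y)` and `O(a | x) = ∑ r, Q(r | x) O(a, ∘ | x, r)`,
weighted with `Q(x, y)`. Indeed, at each pair of questions `O(·, · | x, y)` can be replaced by a
coupling of these two averages, which loses no more than the two excesses, and the couplings form a
non-signalling strategy. This is `TwoPlayerGame.winProb_le_nsValue_add_signalling`; both halves of the
theorem follow from it.

Linear program. The inequality says that the constraints against signalling may be replaced by a
penalty with coefficient `1` for each violation. The minimax theorem turns this into Lagrange
multipliers in `[0, 1]` (`exists_multiplier_le_one`). With the largest reduced payoff at `(x, y)` as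
the multiplier of the normalisation at `(x, y)`, they form a dual solution of value at most the
non-signalling value. An optimal non-signalling strategy, set to zero on questions of probability
zero, is a primal solution with this value, so both are optimal by weak duality.

Threshold bound. In the repeated game the second player's answers are, given `y₁, …, yₙ`, independent
of `x₁, …, xₙ`. So, given the `y`'s and `b`'s, the `x`'s are independent with laws `Q(x | y_j)`, and
the number of instances with `(x, y, b)` is within `n δ` of `Q(x | y)` times the number of instances
with `(y, b)`, up to probability `exp (-n δ² / 2)`; likewise for the first player's answers and for
the questions. When none of these deviations occurs, the empirical frequencies of questions and
answers are, after trimming, `Q` times an almost non-signalling strategy, and the inequality above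
bounds the fraction of instances won by the value plus `3 d δ`
(`TwoPlayerGame.payoff_le_nsValue_add`). With `δ = β / (3 d)`, the union bound over the `d + |X × Y|`
events gives a constant prefactor and the exponent `n β² / (18 d²)`.
-/

/-! ### Couplings of finite sub-probability distributions -/

section Coupling

variable {A B : Type*} [Fintype A] [Fintype B]

/-- Trimming the rows of a nonnegative array so that the row sums obey an upper bound costs no more
mass than the total excess of the row sums over the bound. -/
lemma exists_trim_rows (p : A → B → ℝ) (hp : ∀ a b, 0 ≤ p a b) (μ : A → ℝ) (hμ : ∀ a, 0 ≤ μ a) :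
    ∃ p' : A → B → ℝ, (∀ a b, 0 ≤ p' a b) ∧ (∀ a b, p' a b ≤ p a b) ∧
      (∀ a, ∑ b, p' a b ≤ μ a) ∧
      ∑ a, ∑ b, (p a b - p' a b) = ∑ a, max (∑ b, p a b - μ a) 0 := by
  have hs : ∀ a, 0 ≤ ∑ b, p a b := fun a => Finset.sum_nonneg fun b _ => hp a b
  have key : ∀ a, (∑ b, p a b) * min 1 (μ a / ∑ b, p a b) = min (∑ b, p a b) (μ a) := by
    intro a
    rcases (hs a).eq_or_lt with h | h
    · rw [← h]; simp [hμ a]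
    · rw [mul_min_of_nonneg _ _ h.le, mul_one, mul_div_cancel₀ _ h.ne']
  have hc : ∀ a, 0 ≤ min 1 (μ a / ∑ b, p a b) := fun a =>
    le_min zero_le_one (div_nonneg (hμ a) (hs a))
  refine ⟨fun a b => p a b * min 1 (μ a / ∑ b, p a b), fun a b => mul_nonneg (hp a b) (hc a),
    fun a b => mul_le_of_le_one_right (hp a b) (min_le_left _ _), fun a => ?_, ?_⟩
  · rw [← Finset.sum_mul, key]; exact min_le_right _ _
  · refine Finset.sum_congr rfl fun a _ => ?_
    rw [Finset.sum_sub_distrib, ← Finset.sum_mul, key]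
    rcases le_total (∑ b, p a b) (μ a) with h | h
    · rw [min_eq_left h, max_eq_right (by linarith)]; ring
    · rw [min_eq_right h, max_eq_left (by linarith)]

/-- An array with row and column sums below two probability distributions extends to a coupling of
them: the missing mass is distributed as a product. -/
lemma exists_coupling_ge (p : A → B → ℝ) (μ : A → ℝ) (ν : B → ℝ)
    (hr : ∀ a, ∑ b, p a b ≤ μ a) (hcol : ∀ b, ∑ a, p a b ≤ ν b)
    (hμ : ∑ a, μ a = 1) (hν : ∑ b, ν b = 1) :
    ∃ q : A → B → ℝ, (∀ a b, p a b ≤ q a b) ∧ (∀ a, ∑ b, q a b = μ a) ∧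
      ∀ b, ∑ a, q a b = ν b := by
  set m := ∑ a, ∑ b, p a b with hm
  have hm' : m = ∑ b, ∑ a, p a b := Finset.sum_comm
  have hm1 : m ≤ 1 := hμ ▸ Finset.sum_le_sum fun a _ => hr a
  have hA : ∑ a, (μ a - ∑ b, p a b) = 1 - m := by rw [Finset.sum_sub_distrib, hμ]
  have hB : ∑ b, (ν b - ∑ a, p a b) = 1 - m := by rw [Finset.sum_sub_distrib, hν, hm']
  refine ⟨fun a b => p a b + (μ a - ∑ b, p a b) * (ν b - ∑ a, p a b) / (1 - m),
    fun a b => ?_, fun a => ?_, fun b => ?_⟩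
  · exact le_add_of_nonneg_right (div_nonneg (mul_nonneg (sub_nonneg.2 (hr a))
      (sub_nonneg.2 (hcol b))) (sub_nonneg.2 hm1))
  · rw [Finset.sum_add_distrib, ← Finset.sum_div, ← Finset.mul_sum, hB]
    rcases hm1.lt_or_eq with h | h
    · rw [mul_div_cancel_right₀ _ (by linarith)]; ring
    · -- without missing mass the rows are already full
      have := (Finset.sum_eq_zero_iff_of_nonneg fun a _ => sub_nonneg.2 (hr a)).1
        (hA.trans (by linarith)) a (Finset.mem_univ a)
      rw [this, zero_mul, zero_div]; linarith
  · rw [Finset.sum_add_distrib, ← Finset.sum_div, ← Finset.sum_mul, hA]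
    rcases hm1.lt_or_eq with h | h
    · rw [mul_div_cancel_left₀ _ (by linarith)]; ring
    · have := (Finset.sum_eq_zero_iff_of_nonneg fun b _ => sub_nonneg.2 (hcol b)).1
        (hB.trans (by linarith)) b (Finset.mem_univ b)
      rw [this, mul_zero, zero_div]; linarith

/-- An array `p` can be replaced by a coupling `q` of two given probability distributions in such a
way that, for every payoff with values in `[0, 1]`, no more is lost than the excess of the marginals
of `p` over the given ones. -/
lemma exists_coupling_payoff_le (p : A → B → ℝ) (hp : ∀ a b, 0 ≤ p a b) (μ : A → ℝ) (ν : B → ℝ)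
    (hμ0 : ∀ a, 0 ≤ μ a) (hν0 : ∀ b, 0 ≤ ν b) (hμ : ∑ a, μ a = 1) (hν : ∑ b, ν b = 1) :
    ∃ q : A → B → ℝ, (∀ a b, 0 ≤ q a b) ∧ (∀ a, ∑ b, q a b = μ a) ∧ (∀ b, ∑ a, q a b = ν b) ∧
      ∀ c : A → B → ℝ, (∀ a b, 0 ≤ c a b) → (∀ a b, c a b ≤ 1) →
        ∑ a, ∑ b, c a b * p a b ≤ ∑ a, ∑ b, c a b * q a b +
          (∑ b, max (∑ a, p a b - ν b) 0 + ∑ a, max (∑ b, p a b - μ a) 0) := by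
  obtain ⟨p₁, h0₁, hle₁, hr₁, hs₁⟩ := exists_trim_rows p hp μ hμ0
  obtain ⟨p₂, h0₂, hle₂, hr₂, hs₂⟩ :=
    exists_trim_rows (fun b a => p₁ a b) (fun b a => h0₁ a b) ν hν0
  obtain ⟨q, hq, hqr, hqc⟩ := exists_coupling_ge (fun a b => p₂ b a) μ ν
    (fun a => (Finset.sum_le_sum fun b _ => hle₂ b a).trans (hr₁ a)) hr₂ hμ hν
  refine ⟨q, fun a b => (h0₂ b a).trans (hq a b), hqr, hqc, fun c hc0 hc1 => ?_⟩
  have hs₂' : ∑ a, ∑ b, (p₁ a b - p₂ b a) ≤ ∑ b, max (∑ a, p a b - ν b) 0 := by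
    rw [Finset.sum_comm, hs₂]
    exact Finset.sum_le_sum fun b _ => max_le_max
      (sub_le_sub_right (Finset.sum_le_sum fun a _ => hle₁ a b) _) le_rfl
  have : ∑ a, ∑ b, c a b * p a b ≤ ∑ a, ∑ b, (c a b * q a b + (p₁ a b - p₂ b a) +
      (p a b - p₁ a b)) := by
    refine Finset.sum_le_sum fun a _ => Finset.sum_le_sum fun b _ => ?_
    nlinarith [hq a b, hle₂ b a, hle₁ a b, hc0 a b, hc1 a b]
  simp only [Finset.sum_add_distrib] at this
  linarith

/-- A sub-probability distribution lies below a probability distribution. -/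
lemma exists_distribution_ge [Nonempty A] (μ : A → ℝ) (h0 : ∀ a, 0 ≤ μ a) (h1 : ∑ a, μ a ≤ 1) :
    ∃ μ' : A → ℝ, (∀ a, 0 ≤ μ' a) ∧ (∀ a, μ a ≤ μ' a) ∧ ∑ a, μ' a = 1 := by
  classical
  obtain ⟨a₀⟩ := ‹Nonempty A›
  have h : ∀ a, μ a ≤ μ a + if a = a₀ then 1 - ∑ a, μ a else 0 := fun a =>
    le_add_of_nonneg_right (by split_ifs <;> linarith)
  exact ⟨_, fun a => (h0 a).trans (h a), h, by simp [Finset.sum_add_distrib]⟩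

end Coupling

/-! ### The non-signalling value -/

section Compactness

variable {X Y A B : Type*} [Fintype A] [Fintype B]

lemma isCompact_setOf_isNonSignalling :
    IsCompact {O : X → Y → A → B → ℝ | IsNonSignalling O} := by
  refine (isCompact_Icc (a := (0 : X → Y → A → B → ℝ)) (b := 1)).of_isClosed_subset ?_ ?_
  · have : {O : X → Y → A → B → ℝ | IsNonSignalling O} =
        {O | ∀ x y a b, 0 ≤ O x y a b} ∩ {O | ∀ x y, ∑ a, ∑ b, O x y a b = 1} ∩
        {O | ∀ x x' y b, ∑ a, O x y a b = ∑ a, O x' y a b} ∩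
        {O | ∀ x y y' a, ∑ b, O x y a b = ∑ b, O x y' a b} := by
      ext O
      exact ⟨fun h => ⟨⟨⟨h.1, h.2⟩, h.3⟩, h.4⟩, fun h => ⟨h.1.1.1, h.1.1.2, h.1.2, h.2⟩⟩
    rw [this]
    simp only [Set.ofPred_forall]
    refine ((IsClosed.inter ?_ ?_).inter ?_).inter ?_
    · exact isClosed_iInter fun x => isClosed_iInter fun y => isClosed_iInter fun a =>
        isClosed_iInter fun b => isClosed_le (by fun_prop) (by fun_prop)
    · exact isClosed_iInter fun x => isClosed_iInter fun y =>
        isClosed_eq (by fun_prop) (by fun_prop)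
    · exact isClosed_iInter fun x => isClosed_iInter fun x' => isClosed_iInter fun y =>
        isClosed_iInter fun b => isClosed_eq (by fun_prop) (by fun_prop)
    · exact isClosed_iInter fun x => isClosed_iInter fun y => isClosed_iInter fun y' =>
        isClosed_iInter fun a => isClosed_eq (by fun_prop) (by fun_prop)
  · refine fun O hO => ⟨fun x y a b => hO.nonneg x y a b, fun x y a b => ?_⟩
    have h := hO.sum_one x y
    have h1 := Finset.single_le_sum (f := fun a => ∑ b, O x y a b)
      (fun a _ => Finset.sum_nonneg fun b _ => hO.nonneg x y a b) (Finset.mem_univ a)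
    have h2 := Finset.single_le_sum (f := fun b => O x y a b)
      (fun b _ => hO.nonneg x y a b) (Finset.mem_univ b)
    exact (h2.trans h1).trans h.le

lemma exists_isNonSignalling [Nonempty A] [Nonempty B] :
    ∃ O : X → Y → A → B → ℝ, IsNonSignalling O := by
  classical
  obtain ⟨a₀⟩ := ‹Nonempty A›
  obtain ⟨b₀⟩ := ‹Nonempty B›
  exact ⟨fun _ _ a b => if a = a₀ then (if b = b₀ then 1 else 0) else 0,
    fun _ _ a b => by split_ifs <;> norm_num, fun _ _ => by simp,
    fun _ _ _ _ => rfl, fun _ _ _ _ => rfl⟩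

end Compactness

namespace TwoPlayerGame

section Questions

variable {X Y A B : Type*} [Fintype X] [Fintype Y] (G : TwoPlayerGame X Y A B)

lemma payoff_nonneg (x : X) (y : Y) (a : A) (b : B) :
    (0 : ℝ) ≤ if G.R x y a b then 1 else 0 := by split_ifs <;> norm_num

lemma payoff_le_one (x : X) (y : Y) (a : A) (b : B) :
    (if G.R x y a b then 1 else 0 : ℝ) ≤ 1 := by split_ifs <;> norm_num

lemma condFirst_nonneg (x : X) (y : Y) : 0 ≤ G.condFirst x y :=
  div_nonneg (G.Q_nonneg x y) (Finset.sum_nonneg fun r _ => G.Q_nonneg r y)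

lemma condSecond_nonneg (x : X) (y : Y) : 0 ≤ G.condSecond x y :=
  div_nonneg (G.Q_nonneg x y) (Finset.sum_nonneg fun r _ => G.Q_nonneg x r)

lemma sum_condFirst_le_one (y : Y) : ∑ x, G.condFirst x y ≤ 1 := by
  simp only [condFirst, ← Finset.sum_div]
  exact div_self_le_one _

lemma sum_condSecond_le_one (x : X) : ∑ y, G.condSecond x y ≤ 1 := by
  simp only [condSecond, ← Finset.sum_div]
  exact div_self_le_one _

lemma condFirst_mul_sum (x : X) (y : Y) : G.condFirst x y * ∑ r, G.Q r y = G.Q x y := by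
  refine div_mul_cancel_of_imp fun h => ?_
  exact (Finset.sum_eq_zero_iff_of_nonneg fun r _ => G.Q_nonneg r y).1 h x (Finset.mem_univ x)

lemma condSecond_mul_sum (x : X) (y : Y) : G.condSecond x y * ∑ r, G.Q x r = G.Q x y := by
  refine div_mul_cancel_of_imp fun h => ?_
  exact (Finset.sum_eq_zero_iff_of_nonneg fun r _ => G.Q_nonneg x r).1 h y (Finset.mem_univ y)

lemma weight_pos {η : ℝ} (hη : 0 < η) (x : X) (y : Y) : 0 < G.weight η x y := by
  unfold weight; split_ifs with h
  exacts [(G.Q_nonneg x y).lt_of_ne' h, hη]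

lemma Q_le_weight {η : ℝ} (hη : 0 < η) (x : X) (y : Y) : G.Q x y ≤ G.weight η x y := by
  unfold weight; split_ifs with h
  exacts [le_rfl, (not_not.1 h).trans_le hη.le]

end Questions

variable {X Y A B : Type*} [Fintype X] [Fintype Y] [Fintype A] [Fintype B]
  (G : TwoPlayerGame X Y A B)

lemma winProb_eq (O : X → Y → A → B → ℝ) :
    G.winProb O = ∑ x, ∑ y, G.Q x y * ∑ a, ∑ b, (if G.R x y a b then 1 else 0) * O x y a b := by
  simp only [winProb, Finset.mul_sum, mul_assoc]

lemma winProb_le_one {O : X → Y → A → B → ℝ} (hO : IsNonSignalling O) : G.winProb O ≤ 1 := by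
  rw [winProb_eq]
  refine le_trans ?_ G.Q_sum.le
  refine Finset.sum_le_sum fun x _ => Finset.sum_le_sum fun y _ =>
    mul_le_of_le_one_right (G.Q_nonneg x y) ?_
  refine le_trans ?_ (hO.sum_one x y).le
  exact Finset.sum_le_sum fun a _ => Finset.sum_le_sum fun b _ =>
    mul_le_of_le_one_left (hO.nonneg x y a b) (G.payoff_le_one x y a b)

lemma winProb_le_nsValue {O : X → Y → A → B → ℝ} (hO : IsNonSignalling O) :
    G.winProb O ≤ G.nsValue :=
  le_csSup ⟨1, by rintro _ ⟨O, hO, rfl⟩; exact G.winProb_le_one hO⟩ ⟨O, hO, rfl⟩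

/-- By compactness, the non-signalling value is attained. -/
lemma exists_winProb_eq_nsValue [Nonempty A] [Nonempty B] :
    ∃ O : X → Y → A → B → ℝ, IsNonSignalling O ∧ G.winProb O = G.nsValue := by
  have hc : Continuous fun O : X → Y → A → B → ℝ => G.winProb O := by
    unfold winProb; fun_prop
  obtain ⟨O, hO, hmax⟩ := isCompact_setOf_isNonSignalling.exists_isMaxOn
    exists_isNonSignalling hc.continuousOn
  refine ⟨O, hO, le_antisymm (G.winProb_le_nsValue hO) (csSup_le ⟨_, O, hO, rfl⟩ ?_)⟩
  rintro _ ⟨O', hO', rfl⟩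
  exact hmax hO'

/-- The excess, at questions `(x, y)` and answer `b`, of the second player's marginal over its
average for question `y`. -/
noncomputable def excessFirst (O : X → Y → A → B → ℝ) (x : X) (y : Y) (b : B) : ℝ :=
  ∑ a, O x y a b - ∑ r, G.condFirst r y * ∑ a, O r y a b

/-- The excess, at questions `(x, y)` and answer `a`, of the first player's marginal over its
average for question `x`. -/
noncomputable def excessSecond (O : X → Y → A → B → ℝ) (x : X) (y : Y) (a : A) : ℝ :=
  ∑ b, O x y a b - ∑ r, G.condSecond x r * ∑ b, O x r a b

/-- A signalling strategy beats the non-signalling value by at most its amount of signalling: the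
strategies at the individual questions can be replaced by couplings of the averaged marginals, which
form a non-signalling strategy. The strategy need not be normalised. -/
theorem winProb_le_nsValue_add_signalling [Nonempty A] [Nonempty B] (O : X → Y → A → B → ℝ)
    (h0 : ∀ x y a b, 0 ≤ O x y a b) (h1 : ∀ x y, ∑ a, ∑ b, O x y a b ≤ 1) :
    G.winProb O ≤ G.nsValue +
      (∑ x, ∑ y, ∑ b, G.Q x y * max (G.excessFirst O x y b) 0 +
        ∑ x, ∑ y, ∑ a, G.Q x y * max (G.excessSecond O x y a) 0) := by
  have hμ : ∀ x, ∃ μ : A → ℝ, (∀ a, 0 ≤ μ a) ∧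
      (∀ a, ∑ r, G.condSecond x r * ∑ b, O x r a b ≤ μ a) ∧ ∑ a, μ a = 1 := by
    refine fun x => exists_distribution_ge _ (fun a => Finset.sum_nonneg fun r _ =>
      mul_nonneg (G.condSecond_nonneg x r) (Finset.sum_nonneg fun b _ => h0 x r a b)) ?_
    rw [Finset.sum_comm]
    simp only [← Finset.mul_sum]
    exact (Finset.sum_le_sum fun r _ => mul_le_of_le_one_right (G.condSecond_nonneg x r)
      (h1 x r)).trans (G.sum_condSecond_le_one x)
  have hν : ∀ y, ∃ ν : B → ℝ, (∀ b, 0 ≤ ν b) ∧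
      (∀ b, ∑ r, G.condFirst r y * ∑ a, O r y a b ≤ ν b) ∧ ∑ b, ν b = 1 := by
    refine fun y => exists_distribution_ge _ (fun b => Finset.sum_nonneg fun r _ =>
      mul_nonneg (G.condFirst_nonneg r y) (Finset.sum_nonneg fun a _ => h0 r y a b)) ?_
    rw [Finset.sum_comm]
    simp only [← Finset.mul_sum]
    refine (Finset.sum_le_sum fun r _ => mul_le_of_le_one_right (G.condFirst_nonneg r y)
      ?_).trans (G.sum_condFirst_le_one y)
    rw [Finset.sum_comm]
    exact h1 r y
  choose μ hμ0 hμle hμ1 using hμ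
  choose ν hν0 hνle hν1 using hν
  choose O' hO0 hOr hOc hOle using fun x y =>
    exists_coupling_payoff_le (O x y) (h0 x y) (μ x) (ν y) (hμ0 x) (hν0 y) (hμ1 x) (hν1 y)
  have hns : IsNonSignalling O' :=
    ⟨hO0, fun x y => by simp only [hOr, hμ1], fun x x' y b => by rw [hOc, hOc],
      fun x y y' a => by rw [hOr, hOr]⟩
  refine le_trans ?_ (add_le_add_left (G.winProb_le_nsValue hns) _)
  simp only [winProb_eq, ← Finset.sum_add_distrib]
  refine Finset.sum_le_sum fun x _ => Finset.sum_le_sum fun y _ => ?_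
  simp only [← Finset.mul_sum, ← mul_add]
  refine mul_le_mul_of_nonneg_left ((hOle x y _ (G.payoff_nonneg x y)
    (G.payoff_le_one x y)).trans ?_) (G.Q_nonneg x y)
  refine add_le_add le_rfl (add_le_add ?_ ?_)
  · exact Finset.sum_le_sum fun b _ => max_le_max (sub_le_sub_left (hνle y b) _) le_rfl
  · exact Finset.sum_le_sum fun a _ => max_le_max (sub_le_sub_left (hμle x a) _) le_rfl

end TwoPlayerGame

/-! ### Linear programs: bounded multipliers and weak duality -/

section ExactPenalty

variable {V K : Type*} [Fintype V] [Fintype K]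

/-- If on a compact convex set a linear objective exceeds `w` by at most the total violation of the
constraints `M k · x ≤ 0`, then there are Lagrange multipliers in `[0, 1]` for these constraints:
the total violation is the maximum of `∑ k, y k * (M k · x)` over such multipliers `y`, and the
minimax theorem provides one `y` for all `x`. -/
lemma exists_multiplier_le_one (S : Set (V → ℝ)) (hS : IsCompact S) (hS' : Convex ℝ S)
    (hne : S.Nonempty) (c : V → ℝ) (M : K → V → ℝ) (w : ℝ)
    (h : ∀ x ∈ S, ∑ v, c v * x v ≤ w + ∑ k, max (∑ v, M k v * x v) 0) :
    ∃ y : K → ℝ, (∀ k, 0 ≤ y k) ∧ (∀ k, y k ≤ 1) ∧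
      ∀ x ∈ S, ∑ v, c v * x v ≤ w + ∑ k, y k * ∑ v, M k v * x v := by
  classical
  let f : (K → ℝ) → (V → ℝ) → ℝ := fun y x =>
    ∑ v, c v * x v - ∑ k, y k * ∑ v, M k v * x v
  have hcy : ∀ x, Continuous fun y => f y x := fun x => by simp only [f]; fun_prop
  have hcx : ∀ y, Continuous fun x => f y x := fun y => by simp only [f]; fun_prop
  have hay : ∀ x, ConvexOn ℝ (Set.Icc (0 : K → ℝ) 1) fun y => f y x := fun x => by
    refine ⟨convex_Icc _ _, fun y₁ _ y₂ _ s t _ _ hst => le_of_eq ?_⟩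
    simp only [f, Pi.add_apply, Pi.smul_apply, smul_eq_mul, add_mul, Finset.sum_add_distrib,
      mul_sub, Finset.mul_sum, mul_assoc]
    rw [← Finset.mul_sum, ← Finset.mul_sum, ← sub_eq_zero]
    linear_combination (-∑ v, c v * x v) * hst
  have hax : ∀ y, ConcaveOn ℝ S fun x => f y x := fun y => by
    refine ⟨hS', fun x₁ _ x₂ _ s t _ _ hst => le_of_eq ?_⟩
    simp only [f, Pi.add_apply, Pi.smul_apply, smul_eq_mul, mul_add, Finset.sum_add_distrib,
      mul_sub, Finset.mul_sum, mul_left_comm _ s, mul_left_comm _ t]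
    ring
  obtain ⟨y, hy, x', hx', hsad⟩ := Sion.exists_isSaddlePointOn (X := Set.Icc (0 : K → ℝ) 1)
    (Y := S) (f := f) ⟨0, le_rfl, zero_le_one⟩ (convex_Icc _ _) isCompact_Icc
    (fun x _ => (hcy x).lowerSemicontinuous.lowerSemicontinuousOn _)
    (fun x _ => (hay x).quasiconvexOn) hS' hne hS
    (fun y _ => (hcx y).upperSemicontinuous.upperSemicontinuousOn _)
    (fun y _ => (hax y).quasiconcaveOn)
  refine ⟨y, hy.1, hy.2, fun x hx => ?_⟩
  -- at the maximiser `x'`, compare with the multiplier that charges exactly the violations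
  have h1 := hsad (fun k => if 0 ≤ ∑ v, M k v * x' v then 1 else 0)
    ⟨fun k => by dsimp only [Pi.zero_apply]; split_ifs <;> norm_num,
      fun k => by dsimp only [Pi.one_apply]; split_ifs <;> norm_num⟩ x hx
  have h2 : ∀ k, (if 0 ≤ ∑ v, M k v * x' v then 1 else 0) * ∑ v, M k v * x' v =
      max (∑ v, M k v * x' v) 0 := fun k => by
    split_ifs with hk
    · rw [max_eq_left hk, one_mul]
    · rw [max_eq_right (not_le.1 hk).le, zero_mul]
  simp only [f, h2] at h1
  linarith [h x' hx']

end ExactPenalty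

namespace LinearProgram

variable {V K : Type*} [Fintype V] [Fintype K]

lemma IsFeasible.value_le_dualValue {L : LinearProgram V K} {x : V → ℝ} {y : K → ℝ}
    (hx : L.IsFeasible x) (hy : L.IsDualFeasible y) : L.value x ≤ L.dualValue y := by
  calc L.value x ≤ ∑ v, (∑ k, L.coeff k v * y k) * x v :=
        Finset.sum_le_sum fun v _ => mul_le_mul_of_nonneg_right (hy.2 v) (hx.1 v)
    _ = ∑ k, (∑ v, L.coeff k v * x v) * y k := by
        simp only [Finset.sum_mul]
        rw [Finset.sum_comm]
        exact Finset.sum_congr rfl fun k _ => Finset.sum_congr rfl fun v _ => by ring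
    _ ≤ L.dualValue y :=
        Finset.sum_le_sum fun k _ => mul_le_mul_of_nonneg_right (hx.2 k) (hy.1 k)

end LinearProgram

namespace TwoPlayerGame

/-! ### The modified linear program -/

variable {X Y A B : Type*} [Fintype X] [Fintype Y] (G : TwoPlayerGame X Y A B)

lemma coeff_first [DecidableEq X] [DecidableEq Y] [DecidableEq B] (η : ℝ) (x x' : X) (y y' : Y)
    (a' : A) (b b' : B) : (G.modifiedLP η).coeff (.inl (.inl (x, y, b))) (x', y', a', b') =
      G.weight η x y * ((if x' = x then if y' = y then if b' = b then 1 else 0 else 0 else 0) -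
        (if y' = y then if b' = b then G.condFirst x' y else 0 else 0)) := by
  simp only [modifiedLP, ite_and]
  congr

lemma coeff_second [DecidableEq X] [DecidableEq Y] [DecidableEq A] (η : ℝ) (x x' : X) (y y' : Y)
    (a a' : A) (b' : B) : (G.modifiedLP η).coeff (.inl (.inr (x, y, a))) (x', y', a', b') =
      G.weight η x y * ((if x' = x then if y' = y then if a' = a then 1 else 0 else 0 else 0) -
        (if x' = x then if a' = a then G.condSecond x y' else 0 else 0)) := by
  simp only [modifiedLP, ite_and]
  congr

lemma coeff_norm [DecidableEq X] [DecidableEq Y] (η : ℝ) (x x' : X) (y y' : Y) (a' : A) (b' : B) :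
    (G.modifiedLP η).coeff (.inr (x, y)) (x', y', a', b') =
      if x' = x then if y' = y then 1 else 0 else 0 := by
  simp only [modifiedLP, ite_and]
  congr

variable [Fintype A] [Fintype B]

lemma sum_coeff_first (η : ℝ) (O : StrategyIndex X Y A B → ℝ) (x : X) (y : Y) (b : B) :
    ∑ v, (G.modifiedLP η).coeff (.inl (.inl (x, y, b))) v * O v =
      G.weight η x y * G.excessFirst (fun x y a b => O (x, y, a, b)) x y b := by
  classical
  simp only [Fintype.sum_prod_type, coeff_first, excessFirst, mul_assoc, ← Finset.mul_sum, sub_mul,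
    Finset.sum_sub_distrib, ite_mul, one_mul, zero_mul, Finset.sum_ite_irrel,
    Finset.sum_const_zero, Finset.sum_ite_eq', Finset.mem_univ, if_true]

lemma sum_coeff_second (η : ℝ) (O : StrategyIndex X Y A B → ℝ) (x : X) (y : Y) (a : A) :
    ∑ v, (G.modifiedLP η).coeff (.inl (.inr (x, y, a))) v * O v =
      G.weight η x y * G.excessSecond (fun x y a b => O (x, y, a, b)) x y a := by
  classical
  simp only [Fintype.sum_prod_type, coeff_second, excessSecond, mul_assoc, ← Finset.mul_sum,
    sub_mul, Finset.sum_sub_distrib, ite_mul, one_mul, zero_mul, Finset.sum_ite_irrel,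
    Finset.sum_const_zero, Finset.sum_ite_eq', Finset.mem_univ, if_true]

lemma sum_coeff_norm (η : ℝ) (O : StrategyIndex X Y A B → ℝ) (x : X) (y : Y) :
    ∑ v, (G.modifiedLP η).coeff (.inr (x, y)) v * O v = ∑ a, ∑ b, O (x, y, a, b) := by
  classical
  simp only [Fintype.sum_prod_type, coeff_norm, ite_mul, one_mul, zero_mul, Finset.sum_ite_irrel,
    Finset.sum_const_zero, Finset.sum_ite_eq', Finset.mem_univ, if_true]

lemma value_modifiedLP (η : ℝ) (O : StrategyIndex X Y A B → ℝ) :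
    (G.modifiedLP η).value O = G.winProb fun x y a b => O (x, y, a, b) := by
  simp only [LinearProgram.value, modifiedLP, winProb, Fintype.sum_prod_type]

/-- An optimal non-signalling strategy, set to zero on questions of probability zero, is feasible for
the modified program and has the same winning probability. -/
lemma exists_isFeasible_value_eq [Nonempty A] [Nonempty B] {η : ℝ} (hη : 0 < η) :
    ∃ O, (G.modifiedLP η).IsFeasible O ∧ (G.modifiedLP η).value O = G.nsValue := by
  classical
  obtain ⟨O, hO, hval⟩ := G.exists_winProb_eq_nsValue
  let qX : X → ℝ := fun x => ∑ r, G.Q x r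
  let qY : Y → ℝ := fun y => ∑ r, G.Q r y
  -- `χ` vanishes where an averaged marginal is zero by convention rather than by non-signalling
  let χ : X → Y → ℝ := fun x y => if qX x = 0 ∨ qY y = 0 then 0 else 1
  have hχ0 : ∀ x y, 0 ≤ χ x y := fun x y => by simp only [χ]; split_ifs <;> norm_num
  have hχ1 : ∀ x y, χ x y ≤ 1 := fun x y => by simp only [χ]; split_ifs <;> norm_num
  have hX : ∀ x y, qX x = 0 → G.Q x y = 0 := fun x y h => by
    rw [← G.condSecond_mul_sum]; exact mul_eq_zero_of_right _ h
  have hY : ∀ x y, qY y = 0 → G.Q x y = 0 := fun x y h => by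
    rw [← G.condFirst_mul_sum]; exact mul_eq_zero_of_right _ h
  have hQχ : ∀ x y, G.Q x y * χ x y = G.Q x y := fun x y => by
    simp only [χ]; split_ifs with h
    · rw [mul_zero, h.elim (hX x y) (hY x y)]
    · rw [mul_one]
  have hexF : ∀ x y b, G.excessFirst (fun x y a b => χ x y * O x y a b) x y b ≤ 0 := by
    intro x y b
    have hcond : ∀ r, G.condFirst r y * χ r y = G.condFirst r y := fun r => by
      rw [condFirst, div_mul_eq_mul_div, hQχ]
    simp only [excessFirst, ← Finset.mul_sum, ← mul_assoc, hcond]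
    have hmarg : ∑ r, G.condFirst r y * ∑ a, O r y a b = (∑ r, G.condFirst r y) * ∑ a, O x y a b := by
      rw [Finset.sum_mul]
      exact Finset.sum_congr rfl fun r _ => by rw [hO.first_to_second r x y b]
    rw [hmarg, ← sub_mul]
    refine mul_nonpos_of_nonpos_of_nonneg ?_ (Finset.sum_nonneg fun a _ => hO.nonneg x y a b)
    by_cases h : qY y = 0
    · simp only [χ, h, or_true, if_true, zero_sub, neg_nonpos]
      exact Finset.sum_nonneg fun r _ => G.condFirst_nonneg r y
    · have : ∑ r, G.condFirst r y = 1 := by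
        simp only [condFirst, ← Finset.sum_div]; exact div_self h
      linarith [hχ1 x y]
  have hexS : ∀ x y a, G.excessSecond (fun x y a b => χ x y * O x y a b) x y a ≤ 0 := by
    intro x y a
    have hcond : ∀ r, G.condSecond x r * χ x r = G.condSecond x r := fun r => by
      rw [condSecond, div_mul_eq_mul_div, hQχ]
    simp only [excessSecond, ← Finset.mul_sum, ← mul_assoc, hcond]
    have hmarg : ∑ r, G.condSecond x r * ∑ b, O x r a b = (∑ r, G.condSecond x r) * ∑ b, O x y a b := by
      rw [Finset.sum_mul]
      exact Finset.sum_congr rfl fun r _ => by rw [hO.second_to_first x r y a]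
    rw [hmarg, ← sub_mul]
    refine mul_nonpos_of_nonpos_of_nonneg ?_ (Finset.sum_nonneg fun b _ => hO.nonneg x y a b)
    by_cases h : qX x = 0
    · simp only [χ, h, true_or, if_true, zero_sub, neg_nonpos]
      exact Finset.sum_nonneg fun r _ => G.condSecond_nonneg x r
    · have : ∑ r, G.condSecond x r = 1 := by
        simp only [condSecond, ← Finset.sum_div]; exact div_self h
      linarith [hχ1 x y]
  refine ⟨fun v => χ v.1 v.2.1 * O v.1 v.2.1 v.2.2.1 v.2.2.2,
    ⟨fun v => mul_nonneg (hχ0 _ _) (hO.nonneg _ _ _ _), ?_⟩, ?_⟩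
  · rintro ((⟨x, y, b⟩ | ⟨x, y, a⟩) | ⟨x, y⟩)
    · rw [sum_coeff_first]
      exact mul_nonpos_of_nonneg_of_nonpos (G.weight_pos hη x y).le (hexF x y b)
    · rw [sum_coeff_second]
      exact mul_nonpos_of_nonneg_of_nonpos (G.weight_pos hη x y).le (hexS x y a)
    · rw [sum_coeff_norm]
      simp only [← Finset.mul_sum, hO.sum_one, mul_one]
      exact hχ1 x y
  · rw [value_modifiedLP, ← hval]
    refine Finset.sum_congr rfl fun x _ => Finset.sum_congr rfl fun y _ =>
      Finset.sum_congr rfl fun a _ => Finset.sum_congr rfl fun b _ => ?_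
    rw [mul_right_comm, ← mul_assoc, hQχ, mul_right_comm]

/-- The constraints against signalling have weight at least `Q x y` in the modified program, so their
violation dominates the amount of signalling, and multipliers in `[0, 1]` suffice. -/
lemma exists_isDualFeasible_le_one [Nonempty A] [Nonempty B] {η : ℝ} (hη : 0 < η) :
    ∃ y, (G.modifiedLP η).IsDualFeasible y ∧ (∀ k, y (.inl k) ≤ 1) ∧
      (G.modifiedLP η).dualValue y ≤ G.nsValue := by
  classical
  let S : Set (StrategyIndex X Y A B → ℝ) :=
    {O | 0 ≤ O ∧ ∀ x y, ∑ a, ∑ b, O (x, y, a, b) ≤ 1}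
  have hS : IsCompact S := by
    refine (isCompact_Icc (a := (0 : StrategyIndex X Y A B → ℝ)) (b := 1)).of_isClosed_subset ?_ ?_
    · have h : IsClosed {O : StrategyIndex X Y A B → ℝ |
          ∀ x y, ∑ a, ∑ b, O (x, y, a, b) ≤ 1} := by
        simp only [Set.ofPred_forall]
        exact isClosed_iInter fun x => isClosed_iInter fun y =>
          isClosed_le (by fun_prop) (by fun_prop)
      exact (isClosed_le continuous_const continuous_id).inter h
    · rintro O ⟨h0, h1⟩
      refine ⟨h0, fun ⟨x, y, a, b⟩ => ?_⟩
      have h2 := Finset.single_le_sum (f := fun a => ∑ b, O (x, y, a, b))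
        (fun a _ => Finset.sum_nonneg fun b _ => h0 _) (Finset.mem_univ a)
      have h3 := Finset.single_le_sum (f := fun b => O (x, y, a, b))
        (fun b _ => h0 _) (Finset.mem_univ b)
      exact (h3.trans h2).trans (h1 x y)
  have hSc : Convex ℝ S := by
    rintro O ⟨h0, h1⟩ O' ⟨h0', h1'⟩ s t hs ht hst
    refine ⟨add_nonneg (smul_nonneg hs h0) (smul_nonneg ht h0'), fun x y => ?_⟩
    simp only [Pi.add_apply, Pi.smul_apply, smul_eq_mul, Finset.sum_add_distrib, ← Finset.mul_sum]
    nlinarith [h1 x y, h1' x y]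
  obtain ⟨u, hu0, hu1, hu⟩ := exists_multiplier_le_one S hS hSc
    ⟨0, le_rfl, fun x y => by simp⟩ (G.modifiedLP η).obj
    (fun k => (G.modifiedLP η).coeff (.inl k)) G.nsValue (by
      rintro O ⟨h0, h1⟩
      refine (G.value_modifiedLP η O).trans_le ((G.winProb_le_nsValue_add_signalling _
        (fun x y a b => h0 (x, y, a, b)) h1).trans (add_le_add le_rfl ?_))
      have hmax : ∀ x y t, G.Q x y * max t 0 ≤ max (G.weight η x y * t) 0 := fun x y t => by
        have h := mul_max_of_nonneg t 0 (G.weight_pos hη x y).le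
        rw [mul_zero] at h
        exact h ▸ mul_le_mul_of_nonneg_right (G.Q_le_weight hη x y) (le_max_right _ _)
      have hk : ∀ k, ∑ v, (G.modifiedLP η).coeff (.inl k) v * O v = Sum.elim
          (fun p : X × Y × B => G.weight η p.1 p.2.1 *
            G.excessFirst (fun x y a b => O (x, y, a, b)) p.1 p.2.1 p.2.2)
          (fun p : X × Y × A => G.weight η p.1 p.2.1 *
            G.excessSecond (fun x y a b => O (x, y, a, b)) p.1 p.2.1 p.2.2) k := by
        rintro (⟨x, y, b⟩ | ⟨x, y, a⟩)
        exacts [G.sum_coeff_first η O x y b, G.sum_coeff_second η O x y a]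
      simp only [hk, Fintype.sum_sum_type, Fintype.sum_prod_type, Sum.elim_inl, Sum.elim_inr]
      exact add_le_add
        (Finset.sum_le_sum fun x _ => Finset.sum_le_sum fun y _ =>
          Finset.sum_le_sum fun b _ => hmax x y _)
        (Finset.sum_le_sum fun x _ => Finset.sum_le_sum fun y _ =>
          Finset.sum_le_sum fun a _ => hmax x y _))
  -- The multiplier of the normalisation at `(x, y)` is the largest reduced payoff there.
  let r : StrategyIndex X Y A B → ℝ := fun v =>
    (G.modifiedLP η).obj v - ∑ k, u k * (G.modifiedLP η).coeff (.inl k) v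
  have hr : ∀ O ∈ S, ∑ v, r v * O v ≤ G.nsValue := fun O hO => by
    have := hu O hO
    have h : ∑ v, r v * O v = ∑ v, (G.modifiedLP η).obj v * O v -
        ∑ k, u k * ∑ v, (G.modifiedLP η).coeff (.inl k) v * O v := by
      simp only [r, sub_mul, Finset.sum_sub_distrib, Finset.sum_mul, Finset.mul_sum, mul_assoc]
      rw [Finset.sum_comm]
    linarith
  choose m hm using fun xy : X × Y =>
    Finite.exists_max fun ab : A × B => r (xy.1, xy.2, ab.1, ab.2)
  let z : X × Y → ℝ := fun xy => max (r (xy.1, xy.2, (m xy).1, (m xy).2)) 0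
  refine ⟨Sum.elim u z, ⟨?_, ?_⟩, hu1, ?_⟩
  · rintro (k | xy)
    exacts [hu0 k, le_max_right _ _]
  · rintro ⟨x, y, a, b⟩
    have h1 : ∑ k : X × Y, (G.modifiedLP η).coeff (.inr k) (x, y, a, b) * z k = z (x, y) := by
      rw [Finset.sum_eq_single (x, y)]
      · simp [modifiedLP]
      · rintro ⟨x', y'⟩ _ hne
        have : ¬ (x = x' ∧ y = y') := fun h => hne (by rw [h.1, h.2])
        simp [modifiedLP, this]
      · simp
    have h2 : r (x, y, a, b) ≤ z (x, y) := (hm (x, y) (a, b)).trans (le_max_left _ _)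
    rw [Fintype.sum_sum_type]
    simp only [Sum.elim_inl, Sum.elim_inr, h1]
    simp only [r, mul_comm (u _)] at h2
    linarith
  · -- evaluate the bound on `r` at the strategy answering `m` wherever this has positive payoff
    have h := hr (fun v => if 0 ≤ r v ∧ m (v.1, v.2.1) = (v.2.2.1, v.2.2.2) then 1 else 0)
      ⟨fun v => by dsimp only [Pi.zero_apply]; split_ifs <;> norm_num, fun x y => ?_⟩
    · refine le_trans (le_of_eq ?_) h
      simp only [LinearProgram.dualValue, modifiedLP, zero_mul, one_mul, zero_add, Sum.elim_inr,
        Fintype.sum_sum_type (α₁ := SignallingIndex X Y A B), Finset.sum_const_zero,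
        Fintype.sum_prod_type]
      refine Finset.sum_congr rfl fun x _ => Finset.sum_congr rfl fun y _ => ?_
      rw [← Fintype.sum_prod_type' (f := fun a b => r (x, y, a, b) *
        if 0 ≤ r (x, y, a, b) ∧ m (x, y) = (a, b) then 1 else 0),
        Finset.sum_eq_single (m (x, y)) (fun ab _ hne => by simp [hne.symm]) (by simp)]
      rcases le_total 0 (r (x, y, (m (x, y)).1, (m (x, y)).2)) with h | h
      · simp [z, h]
      · simp only [z, max_eq_right h, Prod.mk.eta, and_true, mul_ite, mul_one, mul_zero]
        split_ifs with h' <;> linarith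
    · rw [← Fintype.sum_prod_type' (f := fun a b =>
        if 0 ≤ r (x, y, a, b) ∧ m (x, y) = (a, b) then (1 : ℝ) else 0),
        Finset.sum_eq_single (m (x, y)) (fun ab _ hne => by simp [hne.symm]) (by simp)]
      split_ifs <;> norm_num

end TwoPlayerGame

namespace TwoPlayerGame

variable {X Y A B : Type*} [Fintype X] [Fintype Y] [Fintype A] [Fintype B]
  (G : TwoPlayerGame X Y A B)

/-! ### Stability of the value under empirical frequencies -/

/-- If a frequency distribution `τ` of questions and answers is non-signalling and compatible with
the question distribution up to errors `δ`, its payoff is at most the non-signalling value up to a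
multiple of `δ`. The proof trims `τ` so that its question marginal is at most `Q`, and divides by `Q`
to obtain a strategy. -/
theorem payoff_le_nsValue_add [Nonempty A] [Nonempty B] (τ : X → Y → A → B → ℝ)
    (h0 : ∀ x y a b, 0 ≤ τ x y a b) {δ : ℝ} (hδ : 0 ≤ δ)
    (hQ : ∀ x y, ∑ a, ∑ b, τ x y a b - G.Q x y ≤ δ)
    (hF : ∀ x y b, ∑ a, τ x y a b - G.condFirst x y * ∑ r, ∑ a, τ r y a b ≤ δ)
    (hS : ∀ x y a, ∑ b, τ x y a b - G.condSecond x y * ∑ r, ∑ b, τ x r a b ≤ δ) :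
    ∑ x, ∑ y, ∑ a, ∑ b, (if G.R x y a b then 1 else 0) * τ x y a b ≤
      G.nsValue + 3 * Fintype.card (SignallingIndex X Y A B) * δ := by
  -- `s x y` is the trimming factor
  have ht : ∀ x y, 0 ≤ ∑ a, ∑ b, τ x y a b := fun x y =>
    Finset.sum_nonneg fun a _ => Finset.sum_nonneg fun b _ => h0 x y a b
  let s : X → Y → ℝ := fun x y => min 1 (G.Q x y / ∑ a, ∑ b, τ x y a b)
  have hs0 : ∀ x y, 0 ≤ s x y := fun x y =>
    le_min zero_le_one (div_nonneg (G.Q_nonneg x y) (ht x y))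
  have hs1 : ∀ x y, s x y ≤ 1 := fun x y => min_le_left _ _
  have hst : ∀ x y, s x y * ∑ a, ∑ b, τ x y a b = min (∑ a, ∑ b, τ x y a b) (G.Q x y) := by
    intro x y
    rcases (ht x y).eq_or_lt with h | h
    · rw [← h]; simp [G.Q_nonneg x y]
    · simp only [s]
      rw [min_mul_of_nonneg _ _ h.le, one_mul, div_mul_cancel₀ _ h.ne']
  let σ : X → Y → A → B → ℝ := fun x y a b => s x y * τ x y a b
  have hσ0 : ∀ x y a b, 0 ≤ σ x y a b := fun x y a b => mul_nonneg (hs0 x y) (h0 x y a b)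
  have hσle : ∀ x y a b, σ x y a b ≤ τ x y a b := fun x y a b =>
    mul_le_of_le_one_left (h0 x y a b) (hs1 x y)
  have hσQ : ∀ x y, ∑ a, ∑ b, σ x y a b ≤ G.Q x y := fun x y => by
    simp only [σ, ← Finset.mul_sum, hst]; exact min_le_right _ _
  have hloss : ∀ x y, ∑ a, ∑ b, (τ x y a b - σ x y a b) ≤ δ := fun x y => by
    simp only [Finset.sum_sub_distrib]
    simp only [σ, ← Finset.mul_sum, hst]
    rcases min_choice (∑ a, ∑ b, τ x y a b) (G.Q x y) with h | h <;> rw [h]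
    · rwa [sub_self]
    · exact hQ x y
  let O : X → Y → A → B → ℝ := fun x y a b => σ x y a b / G.Q x y
  have hQO : ∀ x y a b, G.Q x y * O x y a b = σ x y a b := fun x y a b => by
    refine mul_div_cancel_of_imp' fun h => le_antisymm ?_ (hσ0 x y a b)
    have h2 := Finset.single_le_sum (f := fun a => ∑ b, σ x y a b)
      (fun a _ => Finset.sum_nonneg fun b _ => hσ0 x y a b) (Finset.mem_univ a)
    have h3 := Finset.single_le_sum (f := fun b => σ x y a b)
      (fun b _ => hσ0 x y a b) (Finset.mem_univ b)
    exact (h3.trans h2).trans ((hσQ x y).trans h.le)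
  have hmain := G.winProb_le_nsValue_add_signalling O
    (fun x y a b => div_nonneg (hσ0 x y a b) (G.Q_nonneg x y))
    (fun x y => by
      simp only [O, ← Finset.sum_div]
      exact div_le_one_of_le₀ (hσQ x y) (G.Q_nonneg x y))
  have hexF : ∀ x y b, G.Q x y * max (G.excessFirst O x y b) 0 ≤
      δ + G.condFirst x y * ∑ r, ∑ a, (τ r y a b - σ r y a b) := by
    intro x y b
    have h1 : G.Q x y * ∑ r, G.condFirst r y * ∑ a, O r y a b =
        G.condFirst x y * ∑ r, ∑ a, σ r y a b := by
      simp only [Finset.mul_sum, ← hQO]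
      refine Finset.sum_congr rfl fun r _ => Finset.sum_congr rfl fun a _ => ?_
      rw [← G.condFirst_mul_sum x y, ← G.condFirst_mul_sum r y]; ring
    have h2 : 0 ≤ ∑ r, ∑ a, (τ r y a b - σ r y a b) := Finset.sum_nonneg fun r _ =>
      Finset.sum_nonneg fun a _ => sub_nonneg.2 (hσle r y a b)
    have h3 : ∑ a, σ x y a b ≤ ∑ a, τ x y a b := Finset.sum_le_sum fun a _ => hσle x y a b
    rw [mul_max_of_nonneg _ _ (G.Q_nonneg x y), mul_zero]
    refine max_le ?_ (add_nonneg hδ (mul_nonneg (G.condFirst_nonneg x y) h2))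
    rw [excessFirst, mul_sub, h1, Finset.mul_sum]
    simp only [hQO, Finset.sum_sub_distrib, mul_sub]
    linarith [hF x y b]
  have hexS : ∀ x y a, G.Q x y * max (G.excessSecond O x y a) 0 ≤
      δ + G.condSecond x y * ∑ r, ∑ b, (τ x r a b - σ x r a b) := by
    intro x y a
    have h1 : G.Q x y * ∑ r, G.condSecond x r * ∑ b, O x r a b =
        G.condSecond x y * ∑ r, ∑ b, σ x r a b := by
      simp only [Finset.mul_sum, ← hQO]
      refine Finset.sum_congr rfl fun r _ => Finset.sum_congr rfl fun b _ => ?_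
      rw [← G.condSecond_mul_sum x y, ← G.condSecond_mul_sum x r]; ring
    have h2 : 0 ≤ ∑ r, ∑ b, (τ x r a b - σ x r a b) := Finset.sum_nonneg fun r _ =>
      Finset.sum_nonneg fun b _ => sub_nonneg.2 (hσle x r a b)
    have h3 : ∑ b, σ x y a b ≤ ∑ b, τ x y a b := Finset.sum_le_sum fun b _ => hσle x y a b
    rw [mul_max_of_nonneg _ _ (G.Q_nonneg x y), mul_zero]
    refine max_le ?_ (add_nonneg hδ (mul_nonneg (G.condSecond_nonneg x y) h2))
    rw [excessSecond, mul_sub, h1, Finset.mul_sum]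
    simp only [hQO, Finset.sum_sub_distrib, mul_sub]
    linarith [hS x y a]
  have hlossQ : ∑ x, ∑ y, ∑ a, ∑ b, (τ x y a b - σ x y a b) ≤
      Fintype.card X * Fintype.card Y * δ := by
    calc _ ≤ ∑ _x : X, ∑ _y : Y, δ :=
          Finset.sum_le_sum fun x _ => Finset.sum_le_sum fun y _ => hloss x y
      _ = _ := by simp [mul_assoc]
  have hsumF : ∑ x, ∑ y, ∑ b, G.Q x y * max (G.excessFirst O x y b) 0 ≤
      Fintype.card X * Fintype.card Y * Fintype.card B * δ +
        ∑ x, ∑ y, ∑ a, ∑ b, (τ x y a b - σ x y a b) := by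
    calc _ ≤ ∑ x, ∑ y, ∑ b, (δ + G.condFirst x y * ∑ r, ∑ a, (τ r y a b - σ r y a b)) :=
          Finset.sum_le_sum fun x _ => Finset.sum_le_sum fun y _ =>
            Finset.sum_le_sum fun b _ => hexF x y b
      _ = Fintype.card X * Fintype.card Y * Fintype.card B * δ +
          ∑ y, (∑ x, G.condFirst x y) * ∑ b, ∑ r, ∑ a, (τ r y a b - σ r y a b) := by
        simp only [Finset.sum_add_distrib, ← Finset.mul_sum]
        rw [Finset.sum_comm (f := fun x y => G.condFirst x y * _)]
        simp only [← Finset.sum_mul]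
        simp [mul_assoc]
      _ ≤ Fintype.card X * Fintype.card Y * Fintype.card B * δ +
          ∑ y, ∑ b, ∑ r, ∑ a, (τ r y a b - σ r y a b) := by
        refine add_le_add le_rfl (Finset.sum_le_sum fun y _ => ?_)
        exact mul_le_of_le_one_left (Finset.sum_nonneg fun b _ => Finset.sum_nonneg fun r _ =>
          Finset.sum_nonneg fun a _ => sub_nonneg.2 (hσle r y a b)) (G.sum_condFirst_le_one y)
      _ = _ := by
        congr 1
        rw [Finset.sum_comm (s := (Finset.univ : Finset X))]
        refine Finset.sum_congr rfl fun y _ => ?_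
        rw [Finset.sum_comm]
        exact Finset.sum_congr rfl fun r _ => Finset.sum_comm
  have hsumS : ∑ x, ∑ y, ∑ a, G.Q x y * max (G.excessSecond O x y a) 0 ≤
      Fintype.card X * Fintype.card Y * Fintype.card A * δ +
        ∑ x, ∑ y, ∑ a, ∑ b, (τ x y a b - σ x y a b) := by
    calc _ ≤ ∑ x, ∑ y, ∑ a, (δ + G.condSecond x y * ∑ r, ∑ b, (τ x r a b - σ x r a b)) :=
          Finset.sum_le_sum fun x _ => Finset.sum_le_sum fun y _ =>
            Finset.sum_le_sum fun a _ => hexS x y a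
      _ = Fintype.card X * Fintype.card Y * Fintype.card A * δ +
          ∑ x, (∑ y, G.condSecond x y) * ∑ a, ∑ r, ∑ b, (τ x r a b - σ x r a b) := by
        simp only [Finset.sum_add_distrib, ← Finset.mul_sum, ← Finset.sum_mul]
        simp [mul_assoc]
      _ ≤ Fintype.card X * Fintype.card Y * Fintype.card A * δ +
          ∑ x, ∑ a, ∑ r, ∑ b, (τ x r a b - σ x r a b) := by
        refine add_le_add le_rfl (Finset.sum_le_sum fun x _ => ?_)
        exact mul_le_of_le_one_left (Finset.sum_nonneg fun a _ => Finset.sum_nonneg fun r _ =>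
          Finset.sum_nonneg fun b _ => sub_nonneg.2 (hσle x r a b)) (G.sum_condSecond_le_one x)
      _ = _ := by
        congr 1
        exact Finset.sum_congr rfl fun x _ => Finset.sum_comm
  have hwin : ∑ x, ∑ y, ∑ a, ∑ b, (if G.R x y a b then 1 else 0) * τ x y a b ≤
      G.winProb O + ∑ x, ∑ y, ∑ a, ∑ b, (τ x y a b - σ x y a b) := by
    simp only [winProb, ← Finset.sum_add_distrib]
    refine Finset.sum_le_sum fun x _ => Finset.sum_le_sum fun y _ =>
      Finset.sum_le_sum fun a _ => Finset.sum_le_sum fun b _ => ?_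
    rw [mul_right_comm, hQO]
    nlinarith [hσle x y a b, G.payoff_le_one x y a b]
  have hA : (1 : ℝ) ≤ Fintype.card A := by exact_mod_cast Fintype.card_pos
  have hB : (1 : ℝ) ≤ Fintype.card B := by exact_mod_cast Fintype.card_pos
  have hcard : (Fintype.card (SignallingIndex X Y A B) : ℝ) =
      Fintype.card X * Fintype.card Y * Fintype.card B +
        Fintype.card X * Fintype.card Y * Fintype.card A := by
    simp only [Fintype.card_sum, Fintype.card_prod]; push_cast; ring
  have hXY : 0 ≤ (Fintype.card X : ℝ) * Fintype.card Y * δ := by positivity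
  rw [hcard]
  nlinarith [mul_nonneg hXY (sub_nonneg.2 hA), mul_nonneg hXY (sub_nonneg.2 hB)]

end TwoPlayerGame

/-! ### Exponential moments of centred variables -/

/-- Hoeffding's bound for a centred variable with values in `[-1, 1]`, for an unnormalised measure. -/
lemma sum_mul_exp_le {ι : Type*} [Fintype ι] (q f : ι → ℝ) (hq : ∀ i, 0 ≤ q i)
    (hf : ∀ i, |f i| ≤ 1) (h0 : ∑ i, q i * f i = 0) (t : ℝ) :
    ∑ i, q i * Real.exp (t * f i) ≤ (∑ i, q i) * Real.exp (t ^ 2 / 2) := by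
  have hchord : ∀ i, Real.exp (t * f i) ≤ Real.cosh t + f i * Real.sinh t := by
    intro i
    obtain ⟨h1, h2⟩ := abs_le.1 (hf i)
    have h := convexOn_exp.2 (Set.mem_univ t) (Set.mem_univ (-t))
      (show (0 : ℝ) ≤ (1 + f i) / 2 by linarith) (show (0 : ℝ) ≤ (1 - f i) / 2 by linarith)
      (by ring)
    simp only [smul_eq_mul] at h
    rw [show (1 + f i) / 2 * t + (1 - f i) / 2 * -t = t * f i by ring] at h
    rw [Real.cosh_eq, Real.sinh_eq]
    linarith
  calc ∑ i, q i * Real.exp (t * f i) ≤ ∑ i, q i * (Real.cosh t + f i * Real.sinh t) :=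
        Finset.sum_le_sum fun i _ => mul_le_mul_of_nonneg_left (hchord i) (hq i)
    _ = (∑ i, q i) * Real.cosh t + (∑ i, q i * f i) * Real.sinh t := by
        simp only [mul_add, Finset.sum_add_distrib, Finset.sum_mul, mul_assoc]
    _ ≤ _ := by
        rw [h0, zero_mul, add_zero]
        exact mul_le_mul_of_nonneg_left (Real.cosh_le_exp_half_sq t)
          (Finset.sum_nonneg fun i _ => hq i)

lemma sum_prod_apply {n : ℕ} {X : Type*} [Fintype X] (g : Fin n → X → ℝ) :
    ∑ xs : Fin n → X, ∏ j, g j (xs j) = ∏ j, ∑ x, g j x := by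
  classical
  rw [Finset.prod_univ_sum, Fintype.piFinset_univ]

namespace TwoPlayerGame

variable {X Y A B : Type*} [Fintype X] [Fintype Y] (G : TwoPlayerGame X Y A B)

/-! ### Concentration in the repeated game -/

/-- The game with the roles of the players exchanged. -/
def swap : TwoPlayerGame Y X B A where
  Q y x := G.Q x y
  Q_nonneg y x := G.Q_nonneg x y
  Q_sum := by rw [Finset.sum_comm]; exact G.Q_sum
  R y x b a := G.R x y a b

variable [Fintype A] [Fintype B]

/-- The expectation of a function of all questions and answers, for `n` independent question pairs
and answers drawn from the strategy `P`. -/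
noncomputable def expect {n : ℕ} (P : (Fin n → X) → (Fin n → Y) → (Fin n → A) → (Fin n → B) → ℝ)
    (F : (Fin n → X) → (Fin n → Y) → (Fin n → A) → (Fin n → B) → ℝ) : ℝ :=
  ∑ xs, ∑ ys, ∑ as, ∑ bs, (∏ j, G.Q (xs j) (ys j)) * P xs ys as bs * F xs ys as bs

end TwoPlayerGame

lemma IsNonSignalling.swap {X Y A B : Type*} [Fintype A] [Fintype B] {O : X → Y → A → B → ℝ}
    (hO : IsNonSignalling O) : IsNonSignalling fun y x b a => O x y a b :=
  ⟨fun y x b a => hO.nonneg x y a b, fun y x => by rw [Finset.sum_comm]; exact hO.sum_one x y,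
    fun y y' x a => hO.second_to_first x y y' a, fun y x x' b => hO.first_to_second x x' y b⟩

namespace TwoPlayerGame

variable {X Y A B : Type*} [Fintype X] [Fintype Y] (G : TwoPlayerGame X Y A B)
  [Fintype A] [Fintype B] {n : ℕ} {P : (Fin n → X) → (Fin n → Y) → (Fin n → A) → (Fin n → B) → ℝ}

lemma expect_mono (hP : IsNonSignalling P)
    {F F' : (Fin n → X) → (Fin n → Y) → (Fin n → A) → (Fin n → B) → ℝ}
    (h : ∀ xs ys as bs, F xs ys as bs ≤ F' xs ys as bs) : G.expect P F ≤ G.expect P F' :=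
  Finset.sum_le_sum fun xs _ => Finset.sum_le_sum fun ys _ => Finset.sum_le_sum fun as _ =>
    Finset.sum_le_sum fun bs _ => mul_le_mul_of_nonneg_left (h xs ys as bs)
      (mul_nonneg (Finset.prod_nonneg fun _ _ => G.Q_nonneg _ _) (hP.nonneg xs ys as bs))

lemma expect_sum {ι : Type*} [Fintype ι]
    (F : ι → (Fin n → X) → (Fin n → Y) → (Fin n → A) → (Fin n → B) → ℝ) :
    G.expect P (fun xs ys as bs => ∑ i, F i xs ys as bs) = ∑ i, G.expect P (F i) := by
  simp only [expect, Finset.mul_sum]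
  symm
  rw [Finset.sum_comm]
  refine Finset.sum_congr rfl fun xs _ => ?_
  rw [Finset.sum_comm]
  refine Finset.sum_congr rfl fun ys _ => ?_
  rw [Finset.sum_comm]
  exact Finset.sum_congr rfl fun as _ => Finset.sum_comm

lemma expect_mul_const (F : (Fin n → X) → (Fin n → Y) → (Fin n → A) → (Fin n → B) → ℝ) (c : ℝ) :
    G.expect P (fun xs ys as bs => F xs ys as bs * c) = G.expect P F * c := by
  simp only [expect, Finset.sum_mul, mul_assoc]

lemma expect_swap (F : (Fin n → X) → (Fin n → Y) → (Fin n → A) → (Fin n → B) → ℝ) :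
    G.swap.expect (fun ys xs bs as => P xs ys as bs) (fun ys xs bs as => F xs ys as bs) =
      G.expect P F := by
  simp only [expect, swap]
  rw [Finset.sum_comm]
  exact Finset.sum_congr rfl fun xs _ => Finset.sum_congr rfl fun ys _ => Finset.sum_comm

/-- The moment bound for variables `f x y b` that are centred given `(y, b)`. Here the non-signalling
condition enters: the second player's answers are independent of `x₁, …, xₙ` given `y₁, …, yₙ`. -/
lemma expect_exp_le_first [Nonempty X] (hP : IsNonSignalling P) (f : X → Y → B → ℝ)
    (hf : ∀ x y b, |f x y b| ≤ 1) (h0 : ∀ y b, ∑ x, G.Q x y * f x y b = 0) (t : ℝ) :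
    G.expect P (fun xs ys _ bs => Real.exp (t * ∑ j, f (xs j) (ys j) (bs j))) ≤
      Real.exp (t ^ 2 / 2) ^ n := by
  obtain ⟨x₀⟩ := ‹Nonempty X›
  set c := Real.exp (t ^ 2 / 2)
  let PB : (Fin n → Y) → (Fin n → B) → ℝ := fun ys bs => ∑ as, P (fun _ => x₀) ys as bs
  have hPB : ∀ xs ys bs, ∑ as, P xs ys as bs = PB ys bs := fun xs ys bs =>
    hP.first_to_second _ _ _ _
  have hPB0 : ∀ ys bs, 0 ≤ PB ys bs := fun ys bs => Finset.sum_nonneg fun as _ => hP.nonneg _ _ _ _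
  have hPB1 : ∀ ys, ∑ bs, PB ys bs = 1 := fun ys => by
    rw [Finset.sum_comm]; exact hP.sum_one _ _
  calc G.expect P (fun xs ys _ bs => Real.exp (t * ∑ j, f (xs j) (ys j) (bs j)))
      = ∑ ys, ∑ bs, PB ys bs *
          ∑ xs : Fin n → X, ∏ j, G.Q (xs j) (ys j) * Real.exp (t * f (xs j) (ys j) (bs j)) := by
        rw [expect, Finset.sum_comm]
        refine Finset.sum_congr rfl fun ys _ => ?_
        rw [Finset.sum_congr rfl fun xs _ => Finset.sum_comm, Finset.sum_comm]
        refine Finset.sum_congr rfl fun bs _ => ?_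
        rw [Finset.mul_sum]
        refine Finset.sum_congr rfl fun xs _ => ?_
        have hexp : Real.exp (t * ∑ j, f (xs j) (ys j) (bs j)) =
            ∏ j, Real.exp (t * f (xs j) (ys j) (bs j)) := by rw [Finset.mul_sum, Real.exp_sum]
        rw [← Finset.sum_mul, ← Finset.mul_sum, hPB, Finset.prod_mul_distrib, hexp]
        ring
    _ ≤ ∑ ys, ∑ bs, PB ys bs * ∏ j, ((∑ x, G.Q x (ys j)) * c) := by
        refine Finset.sum_le_sum fun ys _ => Finset.sum_le_sum fun bs _ =>
          mul_le_mul_of_nonneg_left ?_ (hPB0 ys bs)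
        rw [sum_prod_apply fun j x => G.Q x (ys j) * Real.exp (t * f x (ys j) (bs j))]
        exact Finset.prod_le_prod
          (fun j _ => Finset.sum_nonneg fun x _ => mul_nonneg (G.Q_nonneg _ _) (Real.exp_pos _).le)
          fun j _ => sum_mul_exp_le _ _ (fun x => G.Q_nonneg x _) (fun x => hf x _ _) (h0 _ _) t
    _ = c ^ n := by
        simp only [← Finset.sum_mul, hPB1, one_mul]
        rw [sum_prod_apply fun _ y => (∑ x, G.Q x y) * c, Finset.prod_const, Finset.card_univ,
          Fintype.card_fin, ← Finset.sum_mul, Finset.sum_comm, G.Q_sum, one_mul]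

lemma expect_exp_le_question (hP : IsNonSignalling P) (f : X → Y → ℝ)
    (hf : ∀ x y, |f x y| ≤ 1) (h0 : ∑ x, ∑ y, G.Q x y * f x y = 0) (t : ℝ) :
    G.expect P (fun xs ys _ _ => Real.exp (t * ∑ j, f (xs j) (ys j))) ≤
      Real.exp (t ^ 2 / 2) ^ n := by
  calc G.expect P (fun xs ys _ _ => Real.exp (t * ∑ j, f (xs j) (ys j)))
      = ∑ xs : Fin n → X, ∑ ys : Fin n → Y,
          ∏ j, G.Q (xs j) (ys j) * Real.exp (t * f (xs j) (ys j)) := by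
        refine Finset.sum_congr rfl fun xs _ => Finset.sum_congr rfl fun ys _ => ?_
        simp only [← Finset.sum_mul, ← Finset.mul_sum, hP.sum_one, mul_one,
          Finset.prod_mul_distrib]
        rw [Finset.mul_sum, Real.exp_sum]
    _ = (∑ x, ∑ y, G.Q x y * Real.exp (t * f x y)) ^ n := by
        rw [Finset.sum_congr rfl fun (xs : Fin n → X) _ =>
          sum_prod_apply fun j y => G.Q (xs j) y * Real.exp (t * f (xs j) y),
          sum_prod_apply fun _ x => ∑ y, G.Q x y * Real.exp (t * f x y), Finset.prod_const,
          Finset.card_univ, Fintype.card_fin]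
    _ ≤ _ := by
        refine pow_le_pow_left₀ (Finset.sum_nonneg fun x _ => Finset.sum_nonneg fun y _ =>
          mul_nonneg (G.Q_nonneg _ _) (Real.exp_pos _).le) ?_ n
        have h := sum_mul_exp_le (fun p : X × Y => G.Q p.1 p.2) (fun p => f p.1 p.2)
          (fun p => G.Q_nonneg _ _) (fun p => hf _ _)
          (by rw [Fintype.sum_prod_type]; exact h0) t
        simpa only [Fintype.sum_prod_type, G.Q_sum, one_mul] using h

/-- Markov's inequality for exponential moments. -/
lemma expect_indicator_le (hP : IsNonSignalling P)
    (S : (Fin n → X) → (Fin n → Y) → (Fin n → A) → (Fin n → B) → ℝ) (δ : ℝ) (hδ : 0 ≤ δ)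
    (h : G.expect P (fun xs ys as bs => Real.exp (δ * S xs ys as bs)) ≤
      Real.exp (δ ^ 2 / 2) ^ n) :
    G.expect P (fun xs ys as bs => if n * δ < S xs ys as bs then 1 else 0) ≤
      Real.exp (-(n * δ ^ 2 / 2)) := by
  calc _ ≤ G.expect P (fun xs ys as bs =>
        Real.exp (δ * S xs ys as bs) * Real.exp (-(n * δ ^ 2))) := by
        refine G.expect_mono hP fun xs ys as bs => ?_
        split_ifs with hS
        · rw [← Real.exp_add]
          exact Real.one_le_exp (by nlinarith)
        · positivity
    _ ≤ Real.exp (δ ^ 2 / 2) ^ n * Real.exp (-(n * δ ^ 2)) := by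
        rw [expect_mul_const]
        exact mul_le_mul_of_nonneg_right h (Real.exp_pos _).le
    _ = _ := by
        rw [← Real.exp_nat_mul, ← Real.exp_add]; congr 1; ring

lemma expect_exp_le_second [Nonempty Y] (hP : IsNonSignalling P) (f : X → Y → A → ℝ)
    (hf : ∀ x y a, |f x y a| ≤ 1) (h0 : ∀ x a, ∑ y, G.Q x y * f x y a = 0) (t : ℝ) :
    G.expect P (fun xs ys as _ => Real.exp (t * ∑ j, f (xs j) (ys j) (as j))) ≤
      Real.exp (t ^ 2 / 2) ^ n := by
  rw [← expect_swap]
  exact G.swap.expect_exp_le_first hP.swap (fun y x a => f x y a) (fun y x a => hf x y a)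
    (fun x a => h0 x a) t

end TwoPlayerGame

namespace TwoPlayerGame

/-! ### The threshold bound -/

section Deviation

variable {X Y A B : Type*} [Fintype X] [Fintype Y] (G : TwoPlayerGame X Y A B)

lemma condFirst_le_one (x : X) (y : Y) : G.condFirst x y ≤ 1 :=
  (Finset.single_le_sum (f := fun x => G.condFirst x y) (fun x _ => G.condFirst_nonneg x y)
    (Finset.mem_univ x)).trans (G.sum_condFirst_le_one y)

lemma condSecond_le_one (x : X) (y : Y) : G.condSecond x y ≤ 1 :=
  (Finset.single_le_sum (f := fun y => G.condSecond x y) (fun y _ => G.condSecond_nonneg x y)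
    (Finset.mem_univ y)).trans (G.sum_condSecond_le_one x)

lemma Q_le_one (x : X) (y : Y) : G.Q x y ≤ 1 :=
  G.Q_sum ▸ (Finset.single_le_sum (f := fun y => G.Q x y) (fun y _ => G.Q_nonneg x y)
    (Finset.mem_univ y)).trans (Finset.single_le_sum (f := fun x => ∑ y, G.Q x y)
      (fun x _ => Finset.sum_nonneg fun y _ => G.Q_nonneg x y) (Finset.mem_univ x))

/-- An indicator minus a number in `[0, 1]` lies in `[-1, 1]`. -/
lemma abs_indicator_sub_le (p : Prop) [Decidable p] {c : ℝ} (h0 : 0 ≤ c) (h1 : c ≤ 1) :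
    |(if p then 1 else 0) - c| ≤ 1 := by
  rw [abs_le]; split_ifs <;> constructor <;> linarith

variable [DecidableEq X] [DecidableEq Y]

/-- The deviation of the indicator of the first question `x` from its conditional expectation, on
the event that the second question and answer are `(y, b)`. -/
noncomputable def devFirst [DecidableEq B] (x : X) (y : Y) (b : B) (x' : X) (y' : Y) (b' : B) : ℝ :=
  if y' = y then if b' = b then (if x' = x then 1 else 0) - G.condFirst x y else 0 else 0

/-- The deviation of the indicator of the second question `y` from its conditional expectation, on
the event that the first question and answer are `(x, a)`. -/
noncomputable def devSecond [DecidableEq A] (x : X) (y : Y) (a : A) (x' : X) (y' : Y) (a' : A) : ℝ :=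
  if x' = x then if a' = a then (if y' = y then 1 else 0) - G.condSecond x y else 0 else 0

/-- The deviation of the indicator of the questions `(x, y)` from its expectation. -/
noncomputable def devQuestion (x : X) (y : Y) (x' : X) (y' : Y) : ℝ :=
  (if x' = x ∧ y' = y then 1 else 0) - G.Q x y

lemma abs_devFirst_le [DecidableEq B] (x : X) (y : Y) (b : B) (x' : X) (y' : Y) (b' : B) :
    |G.devFirst x y b x' y' b'| ≤ 1 := by
  unfold devFirst
  by_cases hy : y' = y <;> by_cases hb : b' = b <;>
    simp [hy, hb, abs_indicator_sub_le, G.condFirst_nonneg, G.condFirst_le_one]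

lemma abs_devSecond_le [DecidableEq A] (x : X) (y : Y) (a : A) (x' : X) (y' : Y) (a' : A) :
    |G.devSecond x y a x' y' a'| ≤ 1 := by
  unfold devSecond
  by_cases hx : x' = x <;> by_cases ha : a' = a <;>
    simp [hx, ha, abs_indicator_sub_le, G.condSecond_nonneg, G.condSecond_le_one]

lemma sum_Q_mul_devFirst [DecidableEq B] (x : X) (y : Y) (b : B) (y' : Y) (b' : B) :
    ∑ x', G.Q x' y' * G.devFirst x y b x' y' b' = 0 := by
  unfold devFirst
  by_cases hy : y' = y <;> by_cases hb : b' = b <;>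
    simp [hy, hb, mul_sub, Finset.sum_sub_distrib, ← Finset.sum_mul]
  rw [mul_comm, G.condFirst_mul_sum, sub_self]

lemma sum_Q_mul_devSecond [DecidableEq A] (x : X) (y : Y) (a : A) (x' : X) (a' : A) :
    ∑ y', G.Q x' y' * G.devSecond x y a x' y' a' = 0 := by
  unfold devSecond
  by_cases hx : x' = x <;> by_cases ha : a' = a <;>
    simp [hx, ha, mul_sub, Finset.sum_sub_distrib, ← Finset.sum_mul]
  rw [mul_comm, G.condSecond_mul_sum, sub_self]

lemma sum_Q_mul_devQuestion (x : X) (y : Y) :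
    ∑ x', ∑ y', G.Q x' y' * G.devQuestion x y x' y' = 0 := by
  simp [devQuestion, mul_sub, Finset.sum_sub_distrib, ← Finset.sum_mul, G.Q_sum, ite_and,
    Finset.sum_ite_irrel]

end Deviation

variable {X Y A B : Type*} [Fintype X] [Fintype Y] [Fintype A] [Fintype B]
  (G : TwoPlayerGame X Y A B)

/-- If all deviations are small, then the empirical frequencies are nearly non-signalling, and the
fraction of instances won is close to the non-signalling value or below. -/
lemma winFrequency_le [DecidableEq X] [DecidableEq Y] [DecidableEq A] [DecidableEq B]
    [Nonempty A] [Nonempty B] {n : ℕ} (hn : n ≠ 0) {δ : ℝ} (hδ : 0 ≤ δ)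
    (xs : Fin n → X) (ys : Fin n → Y) (as : Fin n → A) (bs : Fin n → B)
    (hF : ∀ x y b, ∑ j, G.devFirst x y b (xs j) (ys j) (bs j) ≤ n * δ)
    (hS : ∀ x y a, ∑ j, G.devSecond x y a (xs j) (ys j) (as j) ≤ n * δ)
    (hQ : ∀ x y, ∑ j, G.devQuestion x y (xs j) (ys j) ≤ n * δ) :
    G.winFrequency xs ys as bs ≤
      G.nsValue + 3 * Fintype.card (SignallingIndex X Y A B) * δ := by
  have hn' : (0 : ℝ) < n := by exact_mod_cast hn.bot_lt
  let N : X → Y → A → B → ℝ := fun x y a b => ∑ j,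
    if xs j = x then if ys j = y then if as j = a then if bs j = b then 1 else 0 else 0 else 0 else 0
  have hN : ∀ x y a b, 0 ≤ N x y a b := fun x y a b => Finset.sum_nonneg fun j _ => by
    split_ifs <;> norm_num
  have hNB : ∀ x y b, ∑ a, N x y a b =
      ∑ j, if xs j = x then if ys j = y then if bs j = b then 1 else 0 else 0 else 0 := by
    intro x y b
    simp only [N]; rw [Finset.sum_comm]
    simp [Finset.sum_ite_irrel]
  have hNA : ∀ x y a, ∑ b, N x y a b =
      ∑ j, if xs j = x then if ys j = y then if as j = a then 1 else 0 else 0 else 0 := by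
    intro x y a
    simp only [N]; rw [Finset.sum_comm]
    simp [Finset.sum_ite_irrel]
  have hNQ : ∀ x y, ∑ a, ∑ b, N x y a b =
      ∑ j, if xs j = x then if ys j = y then 1 else 0 else 0 := by
    intro x y
    simp only [hNA]; rw [Finset.sum_comm]
    simp [Finset.sum_ite_irrel]
  have hwin : G.winFrequency xs ys as bs =
      ∑ x, ∑ y, ∑ a, ∑ b, (if G.R x y a b then 1 else 0) * (N x y a b / n) := by
    have hcount : ∑ x, ∑ y, ∑ a, ∑ b, (if G.R x y a b then 1 else 0) * N x y a b =
        ∑ j, if G.R (xs j) (ys j) (as j) (bs j) then 1 else 0 := by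
      have hj : ∀ j, (if G.R (xs j) (ys j) (as j) (bs j) then 1 else 0 : ℝ) =
          ∑ x, ∑ y, ∑ a, ∑ b, (if G.R x y a b then 1 else 0) *
            if xs j = x then if ys j = y then if as j = a then if bs j = b then 1 else 0
              else 0 else 0 else 0 := fun j => by
        simp only [mul_ite, mul_one, mul_zero, Finset.sum_ite_irrel, Finset.sum_const_zero,
          Finset.sum_ite_eq, Finset.mem_univ, if_true]
      simp only [hj, N, Finset.mul_sum]
      symm
      rw [Finset.sum_comm]
      refine Finset.sum_congr rfl fun x _ => ?_
      rw [Finset.sum_comm]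
      refine Finset.sum_congr rfl fun y _ => ?_
      rw [Finset.sum_comm]
      exact Finset.sum_congr rfl fun a _ => Finset.sum_comm
    simp only [← mul_div_assoc, ← Finset.sum_div, hcount]
    simp [winFrequency]
  rw [hwin]
  refine G.payoff_le_nsValue_add _ (fun x y a b => div_nonneg (hN x y a b) hn'.le) hδ ?_ ?_ ?_
  · intro x y
    have h := hQ x y
    simp only [← Finset.sum_div]
    rw [div_sub' hn'.ne', div_le_iff₀ hn', hNQ]
    simp only [devQuestion, Finset.sum_sub_distrib, ite_and] at h
    simp at h
    linarith
  · intro x y b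
    have h := hF x y b
    simp only [← Finset.sum_div]
    rw [← mul_div_assoc, ← sub_div, div_le_iff₀ hn', hNB]
    have hdev : ∀ j, G.devFirst x y b (xs j) (ys j) (bs j) =
        (if xs j = x then if ys j = y then if bs j = b then 1 else 0 else 0 else 0) -
          G.condFirst x y * if ys j = y then if bs j = b then 1 else 0 else 0 := fun j => by
      unfold devFirst; split_ifs <;> ring
    have hmarg : ∑ r, ∑ a, N r y a b = ∑ j, if ys j = y then if bs j = b then 1 else 0 else 0 := by
      simp only [hNB]; rw [Finset.sum_comm]
      simp
    simp only [hdev, Finset.sum_sub_distrib, ← Finset.mul_sum] at h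
    rw [hmarg]
    linarith
  · intro x y a
    have h := hS x y a
    simp only [← Finset.sum_div]
    rw [← mul_div_assoc, ← sub_div, div_le_iff₀ hn', hNA]
    have hdev : ∀ j, G.devSecond x y a (xs j) (ys j) (as j) =
        (if xs j = x then if ys j = y then if as j = a then 1 else 0 else 0 else 0) -
          G.condSecond x y * if xs j = x then if as j = a then 1 else 0 else 0 := fun j => by
      unfold devSecond; split_ifs <;> ring
    have hmarg : ∑ r, ∑ b, N x r a b = ∑ j, if xs j = x then if as j = a then 1 else 0 else 0 := by
      simp only [hNA]; rw [Finset.sum_comm]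
      simp [Finset.sum_ite_irrel]
    simp only [hdev, Finset.sum_sub_distrib, ← Finset.mul_sum] at h
    rw [hmarg]
    linarith

theorem probWinMoreThan_le [Nonempty A] [Nonempty B] {n : ℕ} (hn : n ≠ 0) {δ : ℝ} (hδ : 0 ≤ δ)
    {P : (Fin n → X) → (Fin n → Y) → (Fin n → A) → (Fin n → B) → ℝ} (hP : IsNonSignalling P) :
    G.probWinMoreThan n P (G.nsValue + 3 * Fintype.card (SignallingIndex X Y A B) * δ) ≤
      (Fintype.card (SignallingIndex X Y A B ⊕ X × Y) : ℝ) * Real.exp (-(n * δ ^ 2 / 2)) := by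
  classical
  have hX : Nonempty X := by
    by_contra h
    rw [not_nonempty_iff] at h
    simpa using G.Q_sum
  have hY : Nonempty Y := by
    by_contra h
    rw [not_nonempty_iff] at h
    simpa using G.Q_sum
  let S : SignallingIndex X Y A B ⊕ X × Y →
      (Fin n → X) → (Fin n → Y) → (Fin n → A) → (Fin n → B) → ℝ := fun k xs ys as bs =>
    match k with
    | .inl (.inl (x, y, b)) => ∑ j, G.devFirst x y b (xs j) (ys j) (bs j)
    | .inl (.inr (x, y, a)) => ∑ j, G.devSecond x y a (xs j) (ys j) (as j)
    | .inr (x, y) => ∑ j, G.devQuestion x y (xs j) (ys j)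
  have hexp : ∀ k, G.expect P (fun xs ys as bs => if n * δ < S k xs ys as bs then 1 else 0) ≤
      Real.exp (-(n * δ ^ 2 / 2)) := by
    intro k
    refine G.expect_indicator_le hP _ δ hδ ?_
    rcases k with ((⟨x, y, b⟩ | ⟨x, y, a⟩) | ⟨x, y⟩)
    · exact G.expect_exp_le_first hP _ (G.abs_devFirst_le x y b) (G.sum_Q_mul_devFirst x y b) δ
    · exact G.expect_exp_le_second hP _ (G.abs_devSecond_le x y a) (G.sum_Q_mul_devSecond x y a) δ
    · exact G.expect_exp_le_question hP _
        (fun x' y' => abs_indicator_sub_le _ (G.Q_nonneg x y) (G.Q_le_one x y))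
        (G.sum_Q_mul_devQuestion x y) δ
  calc G.probWinMoreThan n P (G.nsValue + 3 * Fintype.card (SignallingIndex X Y A B) * δ)
      ≤ G.expect P (fun xs ys as bs => ∑ k, if n * δ < S k xs ys as bs then 1 else 0) := by
        refine G.expect_mono hP fun xs ys as bs => ?_
        have hnn : ∀ k ∈ Finset.univ, (0 : ℝ) ≤ if n * δ < S k xs ys as bs then 1 else 0 :=
          fun k _ => by split_ifs <;> norm_num
        split_ifs with h
        · obtain ⟨k, hk⟩ : ∃ k, n * δ < S k xs ys as bs := by
            by_contra! hall
            exact h.not_ge (G.winFrequency_le hn hδ xs ys as bs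
              (fun x y b => hall (.inl (.inl (x, y, b)))) (fun x y a => hall (.inl (.inr (x, y, a))))
              (fun x y => hall (.inr (x, y))))
          have := Finset.single_le_sum hnn (Finset.mem_univ k)
          rwa [if_pos hk] at this
        · exact Finset.sum_nonneg hnn
    _ ≤ ∑ _k : SignallingIndex X Y A B ⊕ X × Y, Real.exp (-(n * δ ^ 2 / 2)) := by
        rw [expect_sum]
        exact Finset.sum_le_sum fun k _ => hexp k
    _ = _ := by simp only [Finset.sum_const, Finset.card_univ, nsmul_eq_mul]

end TwoPlayerGame

theorem mainTheorem3 {X Y A B : Type*} [Fintype X] [Fintype Y] [Fintype A] [Fintype B]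
    [Nonempty A] [Nonempty B] (G : TwoPlayerGame X Y A B) (α : ℝ) (hα : G.nsValue = 1 - α) :
    -- the modified linear program and its dual
    (∀ η : ℝ, 0 < η →
      (G.modifiedLP η).IsOptimalValue (1 - α) ∧
      ∃ y : SignallingIndex X Y A B ⊕ (X × Y) → ℝ,
        (G.modifiedLP η).IsDualOptimal y ∧
        (∀ k : SignallingIndex X Y A B, y (Sum.inl k) ≤ 1) ∧
        ∑ k : SignallingIndex X Y A B, |y (Sum.inl k)| ≤
          (Fintype.card (SignallingIndex X Y A B) : ℝ)) ∧
    -- the threshold bound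
    ∃ (C₁ : Polynomial ℝ) (C₂ : ℝ), 0 < C₂ ∧
      1 / (20 * (Fintype.card (SignallingIndex X Y A B) : ℝ)) ^ 2 ≤ C₂ ∧
      (∀ n : ℕ, C₁.eval (n : ℝ) <
        10 * 2 * (Fintype.card (X × Y) : ℝ) * (Fintype.card (A × B) : ℝ) *
          ((n : ℝ) + 1) ^ (2 * (Fintype.card (X × Y) * Fintype.card (A × B) - 1))) ∧
      ∀ β : ℝ, 0 < β → β ≤ α →
        ∀ᶠ n : ℕ in Filter.atTop,
          ∀ P : (Fin n → X) → (Fin n → Y) → (Fin n → A) → (Fin n → B) → ℝ,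
            IsNonSignalling P →
              G.probWinMoreThan n P (1 - α + β) ≤
                C₁.eval (n : ℝ) * Real.exp (-C₂ * n * β ^ 2) := by
  constructor
  · intro η hη
    obtain ⟨O, hO, hOval⟩ := G.exists_isFeasible_value_eq hη
    obtain ⟨y, hy, hy1, hyval⟩ := G.exists_isDualFeasible_le_one hη
    rw [hα] at hOval hyval
    refine ⟨⟨⟨O, hO, hOval.symm⟩, ?_⟩, y, ⟨hy, fun y' hy' => ?_⟩, hy1, ?_⟩
    · rintro _ ⟨O', hO', rfl⟩
      exact (hO'.value_le_dualValue hy).trans hyval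
    · exact hyval.trans (hOval ▸ hO.value_le_dualValue hy')
    · calc ∑ k, |y (Sum.inl k)| ≤ ∑ _k : SignallingIndex X Y A B, (1 : ℝ) :=
            Finset.sum_le_sum fun k _ => by rw [abs_of_nonneg (hy.1 _)]; exact hy1 k
        _ = _ := by simp
  · have hXY : Nonempty (X × Y) := by
      by_contra h
      rw [not_nonempty_iff] at h
      have := G.Q_sum
      rw [← Fintype.sum_prod_type' (f := fun x y => G.Q x y)] at this
      simp at this
    have hq : (1 : ℝ) ≤ Fintype.card (X × Y) := by exact_mod_cast Fintype.card_pos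
    have hA : (1 : ℝ) ≤ Fintype.card A := by exact_mod_cast Fintype.card_pos
    have hB : (1 : ℝ) ≤ Fintype.card B := by exact_mod_cast Fintype.card_pos
    have hAB : (Fintype.card (A × B) : ℝ) = Fintype.card A * Fintype.card B := by simp
    set d : ℝ := (Fintype.card (SignallingIndex X Y A B) : ℝ) with hd
    have hdeq : d = Fintype.card (X × Y) * (Fintype.card A + Fintype.card B) := by
      simp only [hd, Fintype.card_sum, Fintype.card_prod]; push_cast; ring
    have hd0 : 0 < d := by rw [hdeq]; positivity
    -- deviations of size `δ = β / (3 d)` have probability `exp (-n δ² / 2)` each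
    refine ⟨Polynomial.C (d + Fintype.card (X × Y)), 1 / (18 * d ^ 2), by positivity, ?_, ?_, ?_⟩
    · exact one_div_le_one_div_of_le (by positivity) (by nlinarith [sq_nonneg d])
    · intro n
      rw [Polynomial.eval_C]
      have hpow : (1 : ℝ) ≤ ((n : ℝ) + 1) ^
          (2 * (Fintype.card (X × Y) * Fintype.card (A × B) - 1)) :=
        one_le_pow₀ (by linarith [Nat.cast_nonneg (α := ℝ) n])
      have h1 : (Fintype.card A : ℝ) + Fintype.card B ≤ 2 * Fintype.card (A × B) := by
        rw [hAB]; nlinarith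
      have h2 : (1 : ℝ) ≤ Fintype.card (A × B) := by rw [hAB]; nlinarith
      calc d + Fintype.card (X × Y) < 10 * 2 * (Fintype.card (X × Y) : ℝ) *
            (Fintype.card (A × B) : ℝ) := by rw [hdeq]; nlinarith
        _ ≤ _ := le_mul_of_one_le_right (by positivity) hpow
    · intro β hβ _
      filter_upwards [Filter.eventually_ne_atTop 0] with n hn P hP
      have h := G.probWinMoreThan_le hn (δ := β / (3 * d)) (by positivity) hP
      have hβd : 3 * d * (β / (3 * d)) = β := by field_simp
      rw [hα, ← hd, hβd] at h
      refine h.trans (le_of_eq ?_)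
      rw [Polynomial.eval_C, Fintype.card_sum, Nat.cast_add, ← hd]
      congr 2
      field_simp
      ring
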